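/- Consider the AWGN channel $y=x+w$ with block length $n\ge 1$, where $w_1,\dots,w_n$ are i.i.d. $\mathcal N(0,\sigma^2)$, and a sparse regression code (SPARC) with power $P>0$; put $\mathsf{snr}=P/\sigma^2>0$ and $\mathcal C=\tfrac12\log(1+\mathsf{snr})$ (natural logarithms). A message vector $\beta\in\mathbb R^{ML}$ consists of $L\ge 2$ sections with $M$ entries each; every section has exactly one non-zero entry, whose value is $\sqrt{P/L}$. The set of these $M^L$ vectors is $\mathcal B_{M,L}$. The codeword is $x=A\beta$, where the design matrix $A\in\{1,-1\}^{n\times ML}$ has i.i.d. entries, uniform on $\{1,-1\}$ (Bernoulli dictionary), independent of the noise, and the rate $R$ is given by $nR=L\log M$. The optimal decoder, which knows $A$, outputs a minimizer $\hat\beta$ of $\|y-Ab\|^2$ over $b\in\mathcal B_{M,L}$ (ties broken arbitrarily). The section error rate $\mathcal E_{\mathsf{sec}}$ is the fraction of the $L$ sections in which $\hat\beta$ and $\beta$ differ, and $\mathbb P(\mathcal E_{\mathsf{sec}}\ge\epsilon)$ is averaged over $\beta$ uniform on $\mathcal B_{M,L}$, over $A$ and over $w$. Let $$g(x)=\sqrt{1+4x^2}-1,\qquad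 w(\mathsf{snr})=\frac{\mathsf{snr}}{2(1+\mathsf{snr})^2\sqrt{4+\mathsf{snr}^3/(1+\mathsf{snr})}},$$ $$h(\epsilon,\Delta)=\min\Big\{\epsilon\,\Delta\,w(\mathsf{snr}),\ \tfrac14\,g\Big(\frac{\Delta}{2\sqrt{\mathsf{snr}}}\Big)\Big\},$$ $$D_1(\delta,u)=\max_{0\le\lambda\le1}\Big\{\lambda\delta+\tfrac12\log(1-\lambda^2u)\Big\},\qquad \mathcal C_\alpha=\tfrac12\log(1+\alpha\,\mathsf{snr}),$$ $$\mathsf a^*_L(\mathsf{snr})=\max_{\alpha\in\{\frac1L,\dots,1-\frac1L\}}\frac{R\,\log\binom{L}{L\alpha}}{D_1\Big(\mathcal C_\alpha-\alpha\,\mathcal C,\ \frac{\alpha(1-\alpha)\mathsf{snr}}{1+\alpha\,\mathsf{snr}}\Big)\,L\log L}.$$ **Theorem.** For every $\mathsf{snr}>0$ there is a function $\iota:\mathbb N\to\mathbb R$, depending only on $\mathsf{snr}$, with $\iota(L)=O(1/\sqrt L)$ as $L\to\infty$, such that the following holds for every such code. Assume that $M=L^{\mathsf a}$ with $\mathsf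 a\ge\mathsf a^*_L(\mathsf{snr})$ and that the gap from capacity $\Delta=\mathcal C-R$ is strictly positive. Then for every $\epsilon>0$ the section error rate of the optimal decoder satisfies $$\mathbb P(\mathcal E_{\mathsf{sec}}\ge\epsilon)=e^{-nE(\epsilon,R)}\qquad\text{with}\qquad E(\epsilon,R)\ \ge\ h(\epsilon,\Delta)-\iota(L)$$ (where $E(\epsilon,R)=+\infty$ if the probability is $0$). -/

import Mathlib

open MeasureTheory ProbabilityTheory Filter Asymptotics
open scoped ENNReal Matrix

noncomputable section

/-! ### Sparse regression codes (SPARCs) with flat power allocation -/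

/-- The length-`ML` message vector (`L` sections with `M` entries each) whose nonzero entry in
section `ℓ` sits at position `s ℓ`; all nonzero entries are equal to `c`. -/
def messageVector {L M : ℕ} (c : ℝ) (s : Fin L → Fin M) : Fin L × Fin M → ℝ :=
  fun j => if j.2 = s j.1 then c else 0

/-- The set `𝓑_{M,L}` of valid message vectors, with nonzero value `c`. -/
def messageSet (L M : ℕ) (c : ℝ) : Set (Fin L × Fin M → ℝ) :=
  Set.range (messageVector c)

/-- The common value `√(P / L)` of the nonzero entries. -/
def flatCoeff (P : ℝ) (L : ℕ) : ℝ := √(P / L)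

/-- The section error rate: the fraction of the `L` sections in which `βhat` and `β` differ. -/
def sectionErrorRate {L M : ℕ} (βhat β : Fin L × Fin M → ℝ) : ℝ :=
  (Set.ncard {ℓ : Fin L | (fun j => βhat (ℓ, j)) ≠ (fun j => β (ℓ, j))} : ℝ) / L

/-- The squared Euclidean norm. -/
def normSqEuclid {n : ℕ} (x : Fin n → ℝ) : ℝ := ∑ i, x i ^ 2

/-- `dec` is an optimal (maximum likelihood, i.e. least squares) decoder: for each design matrix
`A` and channel output `y` it returns a minimizer of `‖y - A b‖²` over the valid message vectors
`b`; ties are broken in an arbitrary way. -/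
def IsOptimalDecoder {n L M : ℕ} (c : ℝ)
    (dec : Matrix (Fin n) (Fin L × Fin M) ℝ → (Fin n → ℝ) → (Fin L × Fin M → ℝ)) : Prop :=
  ∀ A y, dec A y ∈ messageSet L M c ∧
    ∀ b ∈ messageSet L M c, normSqEuclid (y - A *ᵥ dec A y) ≤ normSqEuclid (y - A *ᵥ b)

/-! ### The random model -/

/-- The uniform distribution on `{1, -1} ⊆ ℝ`. -/
def signMeasure : Measure ℝ :=
  (2⁻¹ : ℝ≥0∞) • Measure.dirac 1 + (2⁻¹ : ℝ≥0∞) • Measure.dirac (-1)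

/-- The law of a Bernoulli dictionary: an `n × ML` matrix with i.i.d. entries, uniform on
`{1, -1}`. -/
def bernoulliDictionary (n L M : ℕ) : Measure (Fin n → Fin L × Fin M → ℝ) :=
  Measure.pi fun _ : Fin n => Measure.pi fun _ : Fin L × Fin M => signMeasure

/-- The law of the channel noise: `n` i.i.d. `𝓝(0, σ²)` random variables. -/
def awgnNoise (n : ℕ) (σ : ℝ) : Measure (Fin n → ℝ) :=
  Measure.pi fun _ : Fin n => gaussianReal 0 (Real.toNNReal (σ ^ 2))

/-- The probability `ℙ(𝓔_sec ≥ ε)`, averaged over the `M ^ L` equally likely messages, over the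
Bernoulli dictionary `A` and over the independent noise `w`; the channel output is
`y = A β + w`. -/
def excessErrorProb {n L M : ℕ} (P σ ε : ℝ)
    (dec : Matrix (Fin n) (Fin L × Fin M) ℝ → (Fin n → ℝ) → (Fin L × Fin M → ℝ)) : ℝ≥0∞ :=
  ((M : ℝ≥0∞) ^ L)⁻¹ * ∑ s : Fin L → Fin M,
    ((bernoulliDictionary n L M).prod (awgnNoise n σ))
      {q | ε ≤ sectionErrorRate
        (dec (Matrix.of q.1) (Matrix.of q.1 *ᵥ messageVector (flatCoeff P L) s + q.2))
        (messageVector (flatCoeff P L) s)}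

/-! ### The quantities in the bound -/

/-- `𝓒_α = ½ log (1 + α snr)`. -/
def capacityFrac (snr α : ℝ) : ℝ := 1 / 2 * Real.log (1 + α * snr)

/-- The channel capacity `𝓒 = ½ log (1 + snr)`. -/
def capacity (snr : ℝ) : ℝ := 1 / 2 * Real.log (1 + snr)

/-- `D₁(Δ, u) = max_{0 ≤ t ≤ 1} { t Δ + ½ log (1 - t² u) }`. -/
def chernoffD1 (Δ u : ℝ) : ℝ :=
  sSup ((fun t : ℝ => t * Δ + 1 / 2 * Real.log (1 - t ^ 2 * u)) '' Set.Icc 0 1)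

/-- The threshold `a*_L(snr)` for a code of rate `R`: the maximum over
`α ∈ {1/L, …, 1 - 1/L}`, where `α = k / L`, of
`R log (L choose k) / (D₁(𝓒_α - α 𝓒, α(1-α) snr / (1 + α snr)) L log L)`. -/
def aStar (L : ℕ) (snr R : ℝ) : ℝ :=
  sSup ((fun k : ℕ =>
    (R * Real.log (L.choose k)) /
      (chernoffD1
          (capacityFrac snr ((k : ℝ) / L) - (k : ℝ) / L * capacity snr)
          ((k : ℝ) / L * (1 - (k : ℝ) / L) * snr / (1 + (k : ℝ) / L * snr))
        * L * Real.log L)) '' Set.Icc 1 (L - 1))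

/-- `g(x) = √(1 + 4 x²) - 1`. -/
def gFun (x : ℝ) : ℝ := √(1 + 4 * x ^ 2) - 1

/-- `w(snr) = snr / (2 (1 + snr)² √(4 + snr³ / (1 + snr)))`. -/
def wFun (snr : ℝ) : ℝ :=
  snr / (2 * (1 + snr) ^ 2 * √(4 + snr ^ 3 / (1 + snr)))

/-- `h(ε, Δ) = min { ε Δ w(snr), ¼ g(Δ / (2 √snr)) }`. -/
def hExponent (snr ε Δ : ℝ) : ℝ :=
  min (ε * Δ * wFun snr) (1 / 4 * gFun (Δ / (2 * √snr)))

end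

noncomputable section

/-! ### Elementary inequalities -/

/-! Fix the sent message, divide everything by `σ`, and write `S` for the signal-to-noise ratio, `x`
for the sent codeword and `x'` for a competitor wrong in a fraction `α` of the sections. The decoder
can err towards `x'` only if `‖w + x - x'‖² ≤ ‖w‖²`. Both sides are compared with `‖w + αx‖² / (1 +
α²S)`. For any threshold `t`, either the competitor beats this reference up to `2nt`, or `‖w‖²`
exceeds the reference by `2nt`. The second event does not involve the competitor, so it costs no
union bound, and a Chernoff bound gives it the exponent with `g`. The first pays for at most `M ^
(αL)` competitors and for the binomial choice of wrong sections. A Gallager-type tilt `λ` gives it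
the exponent `tiltExponent λ (𝓒_α - α𝓒 + αΔ - t) u`, less the entropy `log (L choose αL) / n`.

These exponents are Gaussian. For a Bernoulli dictionary they survive because the moments needed are
exponentials of quadratics in sums of signs, and each sign can be replaced by a Gaussian of equal
variance at the cost of a factor `exp (3/4 B²)` with `B = O(1/L)` (`cosh_le_exp_div_add`,
`sign_step`, `lintegral_signs_quadratic_le`). At most `L` signs per averaged sum cost `O(1/L)` in
the exponent.

What remains is deterministic (`exists_hasTilts`). The hypothesis `a ≥ a*_L` says that the entropy
is at most `n` times the exponent at capacity. A positive gap adds `αΔ` to the argument of that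
exponent, whose slope is at least `tiltFloor S > wFun S`, but part of `αΔ` must serve as the
threshold `t`. Far from capacity there is room for both. Close to capacity the slack in the entropy
bound is used: as `h ≤ Δ²/(8S)`, an exponent `h ≥ K/√L` keeps `min(α, 1-α)` at least of order
`L^(-1/4)` there. The entropy is then only about a quarter of what its extreme cases `k = 1` and `k
= L - 1` would suggest by linear scaling. Exponents below `K/√L` make the claim trivial, which is
the source of the `1/√L`; all other losses are `O(1/L)`. -/

lemma half_log_one_sub_le {x : ℝ} (hx : x < 1) : 1 / 2 * Real.log (1 - x) ≤ -(1 / 2) * x := by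
  have := Real.log_le_sub_one_of_pos (show 0 < 1 - x by linarith)
  linarith

lemma le_half_log_one_sub {x : ℝ} (hx : x < 1) :
    -(1 / 2) * (x / (1 - x)) ≤ 1 / 2 * Real.log (1 - x) := by
  have h0 : 0 < 1 - x := by linarith
  have h := Real.one_sub_inv_le_log_of_pos h0
  have : 1 - (1 - x)⁻¹ = -(x / (1 - x)) := by field_simp; ring
  linarith

lemma sq_div_two_le_sub_one_sub_log {r : ℝ} (hr : 0 < r) (hr1 : r ≤ 1) :
    (r - 1) ^ 2 / 2 ≤ r - 1 - Real.log r := by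
  have hd : ∀ x ∈ Set.Ioc (0 : ℝ) 1, HasDerivAt
      (fun r : ℝ => r - 1 - Real.log r - (r - 1) ^ 2 / 2) (-((x - 1) ^ 2 / x)) x := by
    intro x hx
    have hx0 := ne_of_gt hx.1
    refine ((((hasDerivAt_id x).sub_const 1).sub (Real.hasDerivAt_log hx0)).sub
      ((((hasDerivAt_id x).sub_const 1).pow 2).div_const 2)).congr_deriv ?_
    simp only [id]
    field_simp
    ring
  have h : AntitoneOn (fun r : ℝ => r - 1 - Real.log r - (r - 1) ^ 2 / 2) (Set.Ioc 0 1) := by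
    refine antitoneOn_of_deriv_nonpos (convex_Ioc 0 1)
      (fun x hx => (hd x hx).continuousAt.continuousWithinAt)
      (fun x hx => (hd x (interior_subset hx)).differentiableAt.differentiableWithinAt) ?_
    intro x hx
    have hx' := interior_subset hx
    rw [(hd x hx').deriv]
    have := div_nonneg (sq_nonneg (x - 1)) hx'.1.le
    linarith
  have := h ⟨hr, hr1⟩ (show (1 : ℝ) ∈ Set.Ioc 0 1 by simp) hr1
  simp at this
  linarith

lemma sq_div_le_sub_one_sub_log {r : ℝ} (hr1 : 1 ≤ r) :
    (r - 1) ^ 2 / (2 * r) ≤ r - 1 - Real.log r := by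
  have hd : ∀ x ∈ Set.Ici (1 : ℝ), HasDerivAt
      (fun r : ℝ => r - 1 - Real.log r - (r - 2 + r⁻¹) / 2) ((x - 1) ^ 2 / (2 * x ^ 2)) x := by
    intro x hx
    have hx0 : x ≠ 0 := by
      have : (1 : ℝ) ≤ x := hx
      linarith
    refine ((((hasDerivAt_id x).sub_const 1).sub (Real.hasDerivAt_log hx0)).sub
      ((((hasDerivAt_id x).sub_const 2).add (hasDerivAt_inv hx0)).div_const 2)).congr_deriv ?_
    field_simp
    ring
  have h : MonotoneOn (fun r : ℝ => r - 1 - Real.log r - (r - 2 + r⁻¹) / 2) (Set.Ici 1) := by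
    refine monotoneOn_of_deriv_nonneg (convex_Ici 1)
      (fun x hx => (hd x hx).continuousAt.continuousWithinAt)
      (fun x hx => (hd x (interior_subset hx)).differentiableAt.differentiableWithinAt) ?_
    intro x hx
    rw [(hd x (interior_subset hx)).deriv]
    positivity
  have := h (show (1 : ℝ) ∈ Set.Ici 1 by simp) (show r ∈ Set.Ici 1 from hr1) hr1
  have h2 : (r - 1) ^ 2 / (2 * r) = (r - 2 + r⁻¹) / 2 := by
    have : r ≠ 0 := by linarith
    field_simp; ring
  rw [h2]
  simp only [Real.log_one] at this
  norm_num at this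
  linarith

lemma tanh_add_cube_le {s : ℝ} (hs : 0 ≤ s) : Real.tanh s + Real.tanh s ^ 3 / 3 ≤ s := by
  have hd : ∀ x : ℝ, HasDerivAt (fun s => s - Real.tanh s - Real.tanh s ^ 3 / 3)
      (Real.tanh x ^ 4) x := by
    intro x
    have hc := (Real.cosh_pos x).ne'
    have ht : HasDerivAt Real.tanh (1 - Real.tanh x ^ 2) x := by
      have := (Real.hasDerivAt_sinh x).div (Real.hasDerivAt_cosh x) hc
      have h2 : Real.tanh = fun y => Real.sinh y / Real.cosh y := by
        funext y; exact Real.tanh_eq_sinh_div_cosh y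
      rw [h2]
      refine this.congr_deriv ?_
      field_simp
    refine (((hasDerivAt_id x).sub ht).sub ((ht.pow 3).div_const 3)).congr_deriv ?_
    push_cast
    ring
  have hm : Monotone (fun s => s - Real.tanh s - Real.tanh s ^ 3 / 3) :=
    monotone_of_hasDerivAt_nonneg hd fun x => by positivity
  have := hm hs
  simp at this
  linarith

/-- The Legendre transform of `log ∘ cosh`, taken at `t = tanh s`, equals `s t - log (cosh s)` and
has the expansion `t²/2 + t⁴/12 + ⋯`; two terms of it are kept. The quartic one yields the finite
cost in `cosh_le_exp_div_add`. -/
lemma log_cosh_le {s : ℝ} (hs : 0 ≤ s) :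
    Real.log (Real.cosh s) ≤ s * Real.tanh s - Real.tanh s ^ 2 / 2 - Real.tanh s ^ 4 / 12 := by
  set F : ℝ → ℝ := fun s => s * Real.tanh s - Real.tanh s ^ 2 / 2 - Real.tanh s ^ 4 / 12
    - Real.log (Real.cosh s) with hF
  have hd : ∀ x : ℝ, HasDerivAt F
      ((1 - Real.tanh x ^ 2) * (x - Real.tanh x - Real.tanh x ^ 3 / 3)) x := by
    intro x
    have hc := (Real.cosh_pos x).ne'
    have ht : HasDerivAt Real.tanh (1 - Real.tanh x ^ 2) x := by
      have := (Real.hasDerivAt_sinh x).div (Real.hasDerivAt_cosh x) hc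
      have h2 : Real.tanh = fun y => Real.sinh y / Real.cosh y := by
        funext y; exact Real.tanh_eq_sinh_div_cosh y
      rw [h2]
      refine this.congr_deriv ?_
      field_simp
    have hl := (Real.hasDerivAt_cosh x).log hc
    rw [← Real.tanh_eq_sinh_div_cosh] at hl
    refine (((((hasDerivAt_id x).mul ht).sub ((ht.pow 2).div_const 2)).sub
      ((ht.pow 4).div_const 12)).sub hl).congr_deriv ?_
    simp only [id]
    push_cast
    ring
  have hm : MonotoneOn F (Set.Ici 0) := by
    refine monotoneOn_of_deriv_nonneg (convex_Ici 0)
      (fun x _ => (hd x).continuousAt.continuousWithinAt)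
      (fun x _ => (hd x).differentiableAt.differentiableWithinAt) ?_
    intro x hx
    rw [interior_Ici] at hx
    rw [(hd x).deriv]
    have h1 : 0 ≤ 1 - Real.tanh x ^ 2 := by
      have := Real.tanh_sq_lt_one x
      linarith
    exact mul_nonneg h1 (by linarith [tanh_add_cube_le (le_of_lt hx)])
  have := hm (show (0 : ℝ) ∈ Set.Ici 0 by simp) (show s ∈ Set.Ici 0 from hs) hs
  simp [hF] at this
  linarith

/-- For `b ≤ 0` this is weaker than the sub-Gaussian bound. For `b > 0` the Gaussian exponent is too
small near `s = 0`. After AM-GM on `|s| t` with `t = tanh |s|`, the deficit is `t² b / 2 - t⁴ / 12`,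
which is largest at `t² = 3b`; hence the constant `3/4`. -/
lemma cosh_le_exp_div_add {b B : ℝ} (s : ℝ) (hb : -1 < b) (hbB : b ≤ B) :
    Real.cosh s ≤ Real.exp (s ^ 2 / (2 * (1 + b)) + 3 / 4 * B ^ 2) := by
  have hb1 : 0 < 1 + b := by linarith
  rcases le_or_gt b 0 with hb0 | hb0
  · refine (Real.cosh_le_exp_half_sq s).trans (Real.exp_le_exp.2 ?_)
    have : s ^ 2 / 2 ≤ s ^ 2 / (2 * (1 + b)) := by
      apply div_le_div_of_nonneg_left (sq_nonneg s) (by linarith) (by linarith)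
    nlinarith [sq_nonneg B]
  · rw [← Real.cosh_abs, ← Real.log_le_iff_le_exp (Real.cosh_pos _)]
    have h := log_cosh_le (abs_nonneg s)
    set t := Real.tanh |s|
    have h1 : |s| * t ≤ s ^ 2 / (2 * (1 + b)) + t ^ 2 * (1 + b) / 2 := by
      have : s ^ 2 / (2 * (1 + b)) + t ^ 2 * (1 + b) / 2 - |s| * t
          = (|s| - t * (1 + b)) ^ 2 / (2 * (1 + b)) := by
        rw [← sq_abs s]; field_simp; ring
      have h2 : 0 ≤ (|s| - t * (1 + b)) ^ 2 / (2 * (1 + b)) := by positivity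
      linarith
    have h2 : t ^ 2 * b / 2 - t ^ 4 / 12 ≤ 3 / 4 * b ^ 2 := by
      nlinarith [sq_nonneg (t ^ 2 - 3 * b)]
    have h3 : b ^ 2 ≤ B ^ 2 := by gcongr
    linarith

/-! ### The Chernoff exponent as a function of the tilting parameter -/

/-- The function maximized over `t` in the definition of `chernoffD1`. -/
def tiltExponent (t δ u : ℝ) : ℝ := t * δ + 1 / 2 * Real.log (1 - t ^ 2 * u)

/-- `1 - ρ²`, for the correlation `ρ` of the two Gaussian variables compared by the test statistic
of a fraction `α` of wrong sections. -/
def decorrelation (S α : ℝ) : ℝ := α * (1 - α) * S / (1 + α * S)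

/-- `𝓒_α - α 𝓒`. -/
def capacityGap (S α : ℝ) : ℝ := capacityFrac S α - α * capacity S

lemma decorrelation_nonneg {S α : ℝ} (hS : 0 < S) (h0 : 0 ≤ α) (h1 : α ≤ 1) :
    0 ≤ decorrelation S α := by
  have : 0 ≤ 1 - α := by linarith
  unfold decorrelation
  positivity

lemma decorrelation_pos {S α : ℝ} (hS : 0 < S) (h0 : 0 < α) (h1 : α < 1) :
    0 < decorrelation S α := by
  have : 0 < 1 - α := by linarith
  unfold decorrelation
  positivity

lemma one_sub_decorrelation {S α : ℝ} (hS : 0 < S) (h0 : 0 ≤ α) :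
    1 - decorrelation S α = (1 + α ^ 2 * S) / (1 + α * S) := by
  unfold decorrelation
  have : 0 < 1 + α * S := by positivity
  field_simp
  ring

lemma decorrelation_lt_one {S α : ℝ} (hS : 0 < S) (h0 : 0 ≤ α) : decorrelation S α < 1 := by
  have h := one_sub_decorrelation hS h0
  have : 0 < (1 + α ^ 2 * S) / (1 + α * S) := by positivity
  linarith

lemma sq_mul_lt_one {t u : ℝ} (ht0 : 0 ≤ t) (ht1 : t ≤ 1) (hu : u < 1) (hu0 : 0 ≤ u) :
    t ^ 2 * u < 1 := by
  have : t ^ 2 ≤ 1 := pow_le_one₀ ht0 ht1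
  nlinarith

/-- The reciprocal of `1 - decorrelation S α` is `1 + α(1-α)S/(1 + α²S)`, and `α(1-α) ≤ 1/4`. -/
lemma div_one_sub_decorrelation_le {S α : ℝ} (hS : 0 < S) (h0 : 0 ≤ α) (h1 : α ≤ 1) :
    decorrelation S α / (1 - decorrelation S α) ≤ (1 + S / 4) * decorrelation S α := by
  have h := one_sub_decorrelation hS h0
  have hu := decorrelation_nonneg hS h0 h1
  have hpos : 0 < 1 - decorrelation S α := by linarith [decorrelation_lt_one hS h0]
  have : 1 ≤ (1 + S / 4) * (1 - decorrelation S α) := by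
    rw [h, ← mul_div_assoc, le_div_iff₀ (by positivity)]
    nlinarith [mul_nonneg hS.le (sq_nonneg (α - 1 / 2)),
      mul_nonneg (mul_nonneg hS.le hS.le) (sq_nonneg α)]
  rw [div_le_iff₀ hpos]
  nlinarith

/-- The gap is half the Jensen gap of `log` for the points `1` and `1 + S` with weights `1 - α` and
`α` and mean `m`. The linear terms cancel, and the quadratic remainders at the ratios `1/m ≤ 1` and
`(1+S)/m ≥ 1` give the bound. -/
lemma capacityGap_ge {S α : ℝ} (hS : 0 < S) (h0 : 0 ≤ α) (h1 : α ≤ 1) :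
    S / (4 * (1 + S)) * decorrelation S α ≤ capacityGap S α := by
  set m := 1 + α * S with hm
  have hm1 : 1 ≤ m := by have : 0 ≤ α * S := by positivity
                         linarith
  have hmS : m ≤ 1 + S := by nlinarith
  have hm0 : 0 < m := by linarith
  have hα : 0 ≤ 1 - α := by linarith
  have e1 := sq_div_two_le_sub_one_sub_log (r := 1 / m) (by positivity)
    (by rw [div_le_one hm0]; exact hm1)
  have e2 := sq_div_le_sub_one_sub_log (r := (1 + S) / m) (by rw [one_le_div hm0]; exact hmS)
  rw [one_div, Real.log_inv] at e1
  rw [Real.log_div (by positivity) hm0.ne'] at e2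
  have e3 := add_le_add (mul_le_mul_of_nonneg_left e1 hα) (mul_le_mul_of_nonneg_left e2 h0)
  have e4 : (1 - α) * (m⁻¹ - 1 - -Real.log m) + α * ((1 + S) / m - 1 - (Real.log (1 + S)
      - Real.log m)) = Real.log m - α * Real.log (1 + S) := by
    have : (1 - α) * (m⁻¹ - 1) + α * ((1 + S) / m - 1) = 0 := by
      field_simp
      rw [hm]; ring
    linarith
  have e5 : (1 - α) * ((m⁻¹ - 1) ^ 2 / 2) + α * (((1 + S) / m - 1) ^ 2 / (2 * ((1 + S) / m)))
      = S ^ 2 * α * (1 - α) / (2 * m) * ((1 + α * S + α * (1 - α) * S) / (m * (1 + S))) := by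
    field_simp
    rw [hm]; ring
  have e6 : 1 / (1 + S) ≤ (1 + α * S + α * (1 - α) * S) / (m * (1 + S)) := by
    rw [div_le_div_iff₀ (by positivity) (by positivity)]
    have : 0 ≤ α * (1 - α) * S := by positivity
    rw [← hm]
    nlinarith
  have e7 : S ^ 2 * α * (1 - α) / (2 * m) * (1 / (1 + S)) ≤ Real.log m - α * Real.log (1 + S) := by
    rw [← e4]
    refine le_trans ?_ e3
    rw [e5]
    exact mul_le_mul_of_nonneg_left e6 (by positivity)
  unfold capacityGap capacityFrac capacity decorrelation
  rw [← hm]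
  have e8 : S / (4 * (1 + S)) * (α * (1 - α) * S / m)
      = 1 / 2 * (S ^ 2 * α * (1 - α) / (2 * m) * (1 / (1 + S))) := by field_simp; ring
  rw [e8]
  linarith

lemma capacityFrac_le {S α : ℝ} (hS : 0 < S) (h0 : 0 ≤ α) : capacityFrac S α ≤ α * S / 2 := by
  have := Real.log_le_sub_one_of_pos (show 0 < 1 + α * S by positivity)
  unfold capacityFrac
  linarith

lemma capacity_nonneg {S : ℝ} (hS : 0 < S) : 0 ≤ capacity S := by
  have := Real.log_nonneg (show 1 ≤ 1 + S by linarith)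
  unfold capacity
  linarith

lemma capacity_le {S : ℝ} (hS : 0 < S) : capacity S ≤ S / 2 := by
  have := capacityFrac_le hS zero_le_one
  unfold capacityFrac at this
  unfold capacity
  simpa using this

lemma tiltExponent_mono {t δ δ' u : ℝ} (ht : 0 ≤ t) (h : δ ≤ δ') :
    tiltExponent t δ u ≤ tiltExponent t δ' u := by
  unfold tiltExponent
  gcongr

lemma tiltExponent_le {t δ u : ℝ} (h : t ^ 2 * u < 1) :
    tiltExponent t δ u ≤ t * δ - 1 / 2 * t ^ 2 * u := by
  have := half_log_one_sub_le h
  unfold tiltExponent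
  linarith

lemma le_tiltExponent {t δ u : ℝ} (ht0 : 0 ≤ t) (ht1 : t ≤ 1) (hu : u < 1) (hu0 : 0 ≤ u) :
    t * δ - 1 / 2 * t ^ 2 * (u / (1 - u)) ≤ tiltExponent t δ u := by
  have hlt := sq_mul_lt_one ht0 ht1 hu hu0
  have := le_half_log_one_sub hlt
  have ht2 : t ^ 2 ≤ 1 := pow_le_one₀ ht0 ht1
  have h2 : t ^ 2 * u / (1 - t ^ 2 * u) ≤ t ^ 2 * (u / (1 - u)) := by
    rw [mul_div_assoc]
    refine mul_le_mul_of_nonneg_left ?_ (sq_nonneg t)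
    apply div_le_div_of_nonneg_left hu0 (by linarith)
    nlinarith
  unfold tiltExponent
  linarith

/-- A lower bound for the optimal tilting parameter, valid for all `α`. -/
def tiltFloor (S : ℝ) : ℝ := S / ((1 + S) * (4 + S))

lemma tiltFloor_pos {S : ℝ} (hS : 0 < S) : 0 < tiltFloor S := by
  unfold tiltFloor; positivity

lemma tiltFloor_le {S : ℝ} (hS : 0 < S) : tiltFloor S ≤ 1 := by
  unfold tiltFloor
  rw [div_le_one (by positivity)]
  nlinarith

/-- The quadratic minorant of the exponent in `le_tiltExponent` peaks at `δ / (u/(1-u))`. This puts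
the peak at or beyond `tiltFloor S`, uniformly in `α`. -/
lemma tiltFloor_mul_le {S α : ℝ} (hS : 0 < S) (h0 : 0 ≤ α) (h1 : α ≤ 1) :
    tiltFloor S * (decorrelation S α / (1 - decorrelation S α)) ≤ capacityGap S α := by
  refine le_trans ?_ (capacityGap_ge hS h0 h1)
  refine (mul_le_mul_of_nonneg_left (div_one_sub_decorrelation_le hS h0 h1)
    (tiltFloor_pos hS).le).trans (le_of_eq ?_)
  unfold tiltFloor
  field_simp

/-- The exponent gains at least `tiltFloor S * y` when its argument grows by `y`. -/
lemma exists_tiltExponent_add_ge {S α t y : ℝ} (hS : 0 < S) (h0 : 0 ≤ α) (h1 : α ≤ 1)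
    (ht0 : 0 ≤ t) (ht1 : t ≤ 1) (hy : 0 ≤ y) :
    ∃ t' ∈ Set.Icc (0 : ℝ) 1,
      tiltExponent t (capacityGap S α) (decorrelation S α) + tiltFloor S * y
        ≤ tiltExponent t' (capacityGap S α + y) (decorrelation S α) := by
  have hf0 := tiltFloor_pos hS
  have hf1 := tiltFloor_le hS
  have hu0 := decorrelation_nonneg hS h0 h1
  have hu1 := decorrelation_lt_one hS h0
  have hfl := tiltFloor_mul_le hS h0 h1
  set u := decorrelation S α
  set δ := capacityGap S α
  set f := tiltFloor S
  rcases le_or_gt f t with h | h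
  -- The exponent is affine in its argument with slope `t`, so a tilt above the floor can be kept.
  · refine ⟨t, ⟨ht0, ht1⟩, ?_⟩
    unfold tiltExponent
    nlinarith
  -- Raising a smaller tilt to the floor loses nothing: the linear term gains `(f - t) δ`, and by
  -- `e3` the logarithm drops by no more than that.
  · refine ⟨f, ⟨hf0.le, hf1⟩, ?_⟩
    have hp : 0 < 1 - f ^ 2 * u := by linarith [sq_mul_lt_one hf0.le hf1 hu1 hu0]
    have hp' : 0 < 1 - t ^ 2 * u := by linarith [sq_mul_lt_one ht0 ht1 hu1 hu0]
    have hl := Real.log_le_sub_one_of_pos (div_pos hp' hp)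
    rw [Real.log_div hp'.ne' hp.ne'] at hl
    have e1 : (1 - t ^ 2 * u) / (1 - f ^ 2 * u) - 1
        = (f - t) * ((f + t) * (u / (1 - f ^ 2 * u))) := by
      rw [div_sub_one hp.ne', ← mul_div_assoc, ← mul_div_assoc]
      congr 1
      ring
    have e2 : u / (1 - f ^ 2 * u) ≤ u / (1 - u) := by
      apply div_le_div_of_nonneg_left hu0 (by linarith)
      nlinarith [pow_le_one₀ hf0.le hf1 (n := 2)]
    have e3 : (f + t) * (u / (1 - f ^ 2 * u)) ≤ 2 * δ := by
      have : 0 ≤ u / (1 - u) := div_nonneg hu0 (by linarith)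
      calc (f + t) * (u / (1 - f ^ 2 * u)) ≤ (2 * f) * (u / (1 - u)) := by
            refine mul_le_mul (by linarith) e2 (div_nonneg hu0 hp.le) (by linarith)
        _ ≤ 2 * δ := by linarith
    have e4 := mul_le_mul_of_nonneg_left e3 (show 0 ≤ f - t by linarith)
    unfold tiltExponent
    nlinarith

lemma exists_tiltExponent_eq_chernoffD1 {δ u : ℝ} (hu1 : u < 1) (hu0 : 0 ≤ u) :
    ∃ t ∈ Set.Icc (0 : ℝ) 1, chernoffD1 δ u = tiltExponent t δ u := by
  have hc : ContinuousOn (fun t : ℝ => t * δ + 1 / 2 * Real.log (1 - t ^ 2 * u))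
      (Set.Icc 0 1) := by
    refine ContinuousOn.add (by fun_prop) (ContinuousOn.mul (by fun_prop) ?_)
    refine ContinuousOn.log (by fun_prop) fun t ht => ?_
    have := sq_mul_lt_one ht.1 ht.2 hu1 hu0
    linarith
  obtain ⟨t, ht, h⟩ := isCompact_Icc.exists_sSup_image_eq ⟨0, by simp⟩ hc
  exact ⟨t, ht, h⟩

lemma tiltExponent_le_chernoffD1 {t δ u : ℝ} (hu1 : u < 1) (hu0 : 0 ≤ u)
    (ht : t ∈ Set.Icc (0 : ℝ) 1) : tiltExponent t δ u ≤ chernoffD1 δ u := by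
  have hc : ContinuousOn (fun t : ℝ => t * δ + 1 / 2 * Real.log (1 - t ^ 2 * u))
      (Set.Icc 0 1) := by
    refine ContinuousOn.add (by fun_prop) (ContinuousOn.mul (by fun_prop) ?_)
    refine ContinuousOn.log (by fun_prop) fun t ht => ?_
    have := sq_mul_lt_one ht.1 ht.2 hu1 hu0
    linarith
  exact le_csSup (isCompact_Icc.image_of_continuousOn hc).bddAbove ⟨t, ht, rfl⟩

/-- Needed to clear the denominator in `aStar`. At the tilt `tiltFloor S` the linear gain exceeds
the quadratic loss. -/
lemma chernoffD1_pos {S α : ℝ} (hS : 0 < S) (h0 : 0 < α) (h1 : α < 1) :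
    0 < chernoffD1 (capacityGap S α) (decorrelation S α) := by
  have hu := decorrelation_pos hS h0 h1
  have hu1 := decorrelation_lt_one hS h0.le
  have hf := tiltFloor_pos hS
  refine lt_of_lt_of_le ?_ (tiltExponent_le_chernoffD1 hu1 hu.le ⟨hf.le, tiltFloor_le hS⟩)
  refine lt_of_lt_of_le ?_ (le_tiltExponent hf.le (tiltFloor_le hS) hu1 hu.le)
  have h := tiltFloor_mul_le hS h0.le h1.le
  have : 0 < decorrelation S α / (1 - decorrelation S α) := div_pos hu (by linarith)
  have h2 := mul_pos hf this
  nlinarith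

/-! ### The functions `g` and `w` -/

lemma gFun_nonneg (x : ℝ) : 0 ≤ gFun x := by
  unfold gFun
  have := Real.one_le_sqrt.2 (show 1 ≤ 1 + 4 * x ^ 2 by nlinarith [sq_nonneg x])
  linarith

lemma gFun_sq (x : ℝ) : gFun x ^ 2 + 2 * gFun x = 4 * x ^ 2 := by
  unfold gFun
  have := Real.sq_sqrt (show 0 ≤ 1 + 4 * x ^ 2 by positivity)
  nlinarith

lemma gFun_le (x : ℝ) : gFun x ≤ 2 * x ^ 2 := by
  nlinarith [gFun_sq x, sq_nonneg (gFun x)]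

lemma le_gFun {x : ℝ} (hx : 0 ≤ x) : 2 * x ^ 2 / (1 + x) ≤ gFun x := by
  have h := gFun_sq x
  have h0 := gFun_nonneg x
  have h2 : gFun x ≤ 2 * x := by nlinarith
  rw [div_le_iff₀ (by linarith)]
  nlinarith

lemma wFun_nonneg {S : ℝ} (hS : 0 < S) : 0 ≤ wFun S := by
  unfold wFun; positivity

lemma wFun_le {S : ℝ} (hS : 0 < S) : wFun S ≤ S / (4 * (1 + S) ^ 2) := by
  unfold wFun
  have : 2 ≤ √(4 + S ^ 3 / (1 + S)) := by
    apply Real.le_sqrt_of_sq_le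
    have : 0 ≤ S ^ 3 / (1 + S) := by positivity
    linarith
  apply div_le_div_of_nonneg_left hS.le (by positivity)
  nlinarith [sq_nonneg (1 + S)]

lemma wFun_le_sixteenth {S : ℝ} (hS : 0 < S) : wFun S ≤ 1 / 16 := by
  refine (wFun_le hS).trans ?_
  rw [div_le_div_iff₀ (by positivity) (by positivity)]
  nlinarith [sq_nonneg (1 - S)]

/-- The fraction `η = 3S / (4(1+S))` is chosen so that the right side equals the bound of `wFun_le`.
Thus a share `η` of `αΔ` can go to the noise event while the rest still earns `wFun S * αΔ`. -/
lemma wFun_le_tiltFloor_mul {S : ℝ} (hS : 0 < S) :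
    wFun S ≤ tiltFloor S * (1 - 3 * S / (4 * (1 + S))) := by
  refine (wFun_le hS).trans (le_of_eq ?_)
  unfold tiltFloor
  field_simp
  ring

lemma wFun_lt_tiltFloor {S : ℝ} (hS : 0 < S) : wFun S < tiltFloor S := by
  have h := wFun_le_tiltFloor_mul hS
  have : 0 < tiltFloor S * (3 * S / (4 * (1 + S))) := by
    have := tiltFloor_pos hS
    positivity
  linarith

/-- The exponent of the Chernoff bound for the message-independent part of the test statistic. -/
lemma exists_tiltExponent_ge_gFun {x t u : ℝ} (hx : 0 < x) (hu : 0 < u) (h : x * √u ≤ t) :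
    ∃ r : ℝ, 0 ≤ r ∧ r ^ 2 * u < 1 ∧ 1 / 4 * gFun x ≤ tiltExponent r t u := by
  have hs := Real.sqrt_pos.2 hu
  have hsq := Real.sq_sqrt hu.le
  have hg := gFun_sq x
  have hg0 := gFun_nonneg x
  have hgp : 0 < gFun x := by
    rcases hg0.eq_or_lt with h0 | h0
    · rw [← h0] at hg; nlinarith [pow_pos hx 2]
    · exact h0
  set g := gFun x
  -- The tilt `g / (2x√u)` is the exact maximizer when `t = x√u`. The value there is `g/2 - 1/2 log
  -- (1 + g/2)`, which is at least `g/4`.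
  have e1 : (g / (2 * x) / √u) ^ 2 * u = g / (g + 2) := by
    rw [div_pow, hsq, div_mul_cancel₀ _ hu.ne', div_pow, mul_pow,
      show (2 : ℝ) ^ 2 * x ^ 2 = g ^ 2 + 2 * g by linarith]
    field_simp
  refine ⟨g / (2 * x) / √u, by positivity, ?_, ?_⟩
  · rw [e1, div_lt_one (by linarith)]; linarith
  · unfold tiltExponent
    rw [e1]
    have e2 : g / 2 ≤ g / (2 * x) / √u * t := by
      rw [div_div, div_mul_eq_mul_div, div_le_div_iff₀ (by positivity) (by positivity)]
      nlinarith
    have e3 : 1 - g / (g + 2) = (1 + g / 2)⁻¹ := by field_simp; ring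
    rw [e3, Real.log_inv]
    have := Real.log_le_sub_one_of_pos (show 0 < 1 + g / 2 by linarith)
    linarith

/-! ### Behaviour of the exponent when few or almost all sections are wrong -/

lemma exists_max_sub_sq {a b : ℝ} (ha : 0 < a) (hb : 0 < b) :
    ∃ d > 0, ∃ t₀ ∈ Set.Icc (0 : ℝ) 1, t₀ * a - 1 / 2 * t₀ ^ 2 * b = d ∧
      ∀ t ∈ Set.Icc (0 : ℝ) 1, t * a - 1 / 2 * t ^ 2 * b ≤ d := by
  obtain ⟨t₀, ht₀, h⟩ := isCompact_Icc.exists_isMaxOn (s := Set.Icc (0 : ℝ) 1) ⟨0, by simp⟩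
    (f := fun t => t * a - 1 / 2 * t ^ 2 * b) (by fun_prop)
  refine ⟨_, ?_, t₀, ht₀, rfl, fun t ht => h ht⟩
  have hm0 : 0 < min 1 (a / b) := lt_min one_pos (div_pos ha hb)
  refine lt_of_lt_of_le ?_ (h ⟨hm0.le, min_le_left _ _⟩)
  have h2 : min 1 (a / b) * b ≤ a := by
    calc min 1 (a / b) * b ≤ a / b * b := by gcongr; exact min_le_right _ _
      _ = a := by field_simp
  change 0 < min 1 (a / b) * a - 1 / 2 * min 1 (a / b) ^ 2 * b
  nlinarith

/-- To first order in `m` the gap is `m (S - log (1+S))/2` and the decorrelation is `m S`, so the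
exponent is `m` times a fixed concave parabola in `t`, up to `O(m²)` uniformly in `t`; `d` is the
maximum of the parabola. The upper bound at `m = 1/L` controls `log L`; the lower bound supplies the
exponent at a general small fraction. -/
lemma tiltExponent_expansion_zero {S : ℝ} (hS : 0 < S) :
    ∃ d > 0, ∃ Q ≥ 0, ∃ t₀ ∈ Set.Icc (0 : ℝ) 1, ∀ m : ℝ, 0 < m → m ≤ 1 / 2 →
      (∀ t ∈ Set.Icc (0 : ℝ) 1,
        tiltExponent t (capacityGap S m) (decorrelation S m) ≤ m * (d + Q * m)) ∧
      m * (d - Q * m) ≤ tiltExponent t₀ (capacityGap S m) (decorrelation S m) := by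
  have ha : 0 < (S - Real.log (1 + S)) / 2 := by
    have := Real.log_lt_sub_one_of_pos (show 0 < 1 + S by linarith) (by linarith)
    linarith
  obtain ⟨d, hd, t₀, ht₀, hdt, hmax⟩ := exists_max_sub_sq ha hS
  refine ⟨d, hd, S * (1 + S), by positivity, t₀, ht₀, fun m hm0 hm1 => ⟨fun t ht => ?_, ?_⟩⟩
  · have hu0 := decorrelation_nonneg hS hm0.le (by linarith)
    have hu1 := decorrelation_lt_one hS hm0.le
    refine (tiltExponent_le (sq_mul_lt_one ht.1 ht.2 hu1 hu0)).trans ?_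
    have hδ : capacityGap S m ≤ m * ((S - Real.log (1 + S)) / 2) := by
      have := capacityFrac_le hS hm0.le
      unfold capacityGap capacity
      linarith
    have hu : m * S * (1 - (1 + S) * m) ≤ decorrelation S m := by
      unfold decorrelation
      rw [le_div_iff₀ (by positivity)]
      have : 0 ≤ m ^ 3 * S ^ 2 * (1 + S) := by positivity
      nlinarith
    have h1 := hmax t ht
    have ht2 : t ^ 2 ≤ 1 := pow_le_one₀ ht.1 ht.2
    have h2 := mul_le_mul_of_nonneg_left hδ ht.1
    have h3 := mul_le_mul_of_nonneg_left hu (sq_nonneg t)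
    have h4 : t ^ 2 * (m * S * ((1 + S) * m)) ≤ 1 * (m * S * ((1 + S) * m)) := by
      gcongr
    have h5 := mul_le_mul_of_nonneg_left h1 hm0.le
    have h6 : 0 ≤ m * S * ((1 + S) * m) := by positivity
    nlinarith
  · have hu0 := decorrelation_nonneg hS hm0.le (by linarith)
    have hu1 := decorrelation_lt_one hS hm0.le
    refine le_trans ?_ (le_tiltExponent ht₀.1 ht₀.2 hu1 hu0)
    have hδ : m * ((S - Real.log (1 + S)) / 2 - S ^ 2 * m) ≤ capacityGap S m := by
      have h := Real.one_sub_inv_le_log_of_pos (show 0 < 1 + m * S by positivity)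
      have h2 : m * S - (m * S) ^ 2 ≤ 1 - (1 + m * S)⁻¹ := by
        have : 1 - (1 + m * S)⁻¹ = m * S / (1 + m * S) := by field_simp; ring
        rw [this, le_div_iff₀ (by positivity)]
        have : 0 ≤ (m * S) ^ 3 := by positivity
        nlinarith
      unfold capacityGap capacity capacityFrac
      nlinarith [mul_pos hm0 hm0, mul_pos hS hS]
    have hu : decorrelation S m / (1 - decorrelation S m) ≤ m * S := by
      rw [one_sub_decorrelation hS hm0.le]
      unfold decorrelation
      rw [div_div_div_cancel_right₀ (by positivity), div_le_iff₀ (by positivity)]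
      have : 0 ≤ m ^ 3 * S ^ 2 := by positivity
      have : 0 ≤ m ^ 2 * S := by positivity
      nlinarith
    have h2 := mul_le_mul_of_nonneg_left hδ ht₀.1
    have h3 := mul_le_mul_of_nonneg_left hu (sq_nonneg t₀)
    have h4 : t₀ * (S ^ 2 * m * m) ≤ 1 * (S ^ 2 * m * m) := by
      have := ht₀.2
      gcongr
    have h5 : 0 ≤ S * m * m := by positivity
    rw [← hdt]
    nlinarith

/-- The same at the other end. With `q = S/(1+S)` one has `1 + (1-m)S = (1+S)(1 - mq)`, so to first
order the gap is `m (𝓒 - q/2)` and the decorrelation is `m q`. -/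
lemma tiltExponent_expansion_one {S : ℝ} (hS : 0 < S) :
    ∃ d > 0, ∃ Q ≥ 0, ∃ t₀ ∈ Set.Icc (0 : ℝ) 1, ∀ m : ℝ, 0 < m → m ≤ 1 / 2 →
      (∀ t ∈ Set.Icc (0 : ℝ) 1,
        tiltExponent t (capacityGap S (1 - m)) (decorrelation S (1 - m)) ≤ m * (d + Q * m)) ∧
      m * (d - Q * m) ≤ tiltExponent t₀ (capacityGap S (1 - m)) (decorrelation S (1 - m)) := by
  set q := S / (1 + S) with hq
  have hq0 : 0 < q := by positivity
  have hq1 : q < 1 := by rw [hq, div_lt_one (by linarith)]; linarith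
  have ha : 0 < capacity S - q / 2 := by
    have h := Real.log_lt_sub_one_of_pos (show 0 < (1 + S)⁻¹ by positivity)
      (by rw [Ne, inv_eq_one]; linarith)
    rw [Real.log_inv] at h
    have : (1 + S)⁻¹ - 1 = -q := by rw [hq]; field_simp; ring
    unfold capacity
    linarith
  obtain ⟨d, hd, t₀, ht₀, hdt, hmax⟩ := exists_max_sub_sq ha hq0
  have hgap : ∀ m : ℝ, 0 < m → m ≤ 1 / 2 →
      capacityGap S (1 - m) = m * capacity S + 1 / 2 * Real.log (1 - m * q) := by
    intro m hm0 hm1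
    have h1 : 0 < 1 - m * q := by nlinarith
    have : 1 + (1 - m) * S = (1 + S) * (1 - m * q) := by rw [hq]; field_simp; ring
    unfold capacityGap capacityFrac capacity
    rw [this, Real.log_mul (by positivity) h1.ne']
    ring
  refine ⟨d, hd, 3, by norm_num, t₀, ht₀, fun m hm0 hm1 => ⟨fun t ht => ?_, ?_⟩⟩
  · have hu0 := decorrelation_nonneg (α := 1 - m) hS (by linarith) (by linarith)
    have hu1 := decorrelation_lt_one (α := 1 - m) hS (by linarith)
    refine (tiltExponent_le (sq_mul_lt_one ht.1 ht.2 hu1 hu0)).trans ?_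
    have hmq : m * q < 1 := by nlinarith
    have hδ : capacityGap S (1 - m) ≤ m * (capacity S - q / 2) := by
      have := half_log_one_sub_le hmq
      rw [hgap m hm0 hm1]
      linarith
    have hu : m * q * (1 - m) ≤ decorrelation S (1 - m) := by
      have : decorrelation S (1 - m) = m * q * (1 - m) / (1 - m * q) := by
        unfold decorrelation
        have h1 : 1 + (1 - m) * S = (1 + S) * (1 - m * q) := by rw [hq]; field_simp; ring
        have h2 : S = (1 + S) * q := by rw [hq]; field_simp
        rw [h1, show (1 - m) * (1 - (1 - m)) * S = (1 - m) * m * ((1 + S) * q) by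
          rw [← h2]; ring]
        rw [show (1 - m) * m * ((1 + S) * q) = (1 + S) * (m * q * (1 - m)) by ring]
        exact mul_div_mul_left _ _ (by positivity)
      rw [this, le_div_iff₀ (by linarith)]
      have : 0 ≤ m * q * (1 - m) := by
        have : 0 ≤ 1 - m := by linarith
        positivity
      have : 0 ≤ m * q := by positivity
      nlinarith
    have h1 := hmax t ht
    have ht2 : t ^ 2 ≤ 1 := pow_le_one₀ ht.1 ht.2
    have h2 := mul_le_mul_of_nonneg_left hδ ht.1
    have h3 := mul_le_mul_of_nonneg_left hu (sq_nonneg t)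
    have h4 : t ^ 2 * (m * m * q) ≤ 1 * (m * m * 1) := by
      gcongr
    have h5 := mul_le_mul_of_nonneg_left h1 hm0.le
    nlinarith [mul_pos hm0 hm0]
  · have hu0 := decorrelation_nonneg (α := 1 - m) hS (by linarith) (by linarith)
    have hu1 := decorrelation_lt_one (α := 1 - m) hS (by linarith)
    refine le_trans ?_ (le_tiltExponent ht₀.1 ht₀.2 hu1 hu0)
    have hmq : m * q < 1 / 2 := by nlinarith
    have hδ : m * (capacity S - q / 2 - m) ≤ capacityGap S (1 - m) := by
      have h := le_half_log_one_sub (show m * q < 1 by linarith)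
      have h2 : m * q / (1 - m * q) ≤ m * q + 2 * (m * q) ^ 2 := by
        rw [div_le_iff₀ (by linarith)]
        have : 0 ≤ (m * q) ^ 2 := by positivity
        nlinarith
      have h3 : (m * q) ^ 2 ≤ m ^ 2 := by
        have : m * q ≤ m := by nlinarith
        gcongr
      rw [hgap m hm0 hm1]
      nlinarith
    have hu : decorrelation S (1 - m) / (1 - decorrelation S (1 - m)) ≤ m * q + 2 * m ^ 2 := by
      have h1 : decorrelation S (1 - m) / (1 - decorrelation S (1 - m)) ≤ m * q / (1 - m) := by
        rw [one_sub_decorrelation (α := 1 - m) hS (by linarith)]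
        unfold decorrelation
        have : 0 < 1 + (1 - m) * S := by nlinarith
        have h1m : 0 < 1 - m := by linarith
        rw [div_div_div_cancel_right₀ this.ne', div_le_div_iff₀ (by positivity) h1m, hq]
        have : m * (S / (1 + S)) * (1 + (1 - m) ^ 2 * S) =
            m * S * ((1 + (1 - m) ^ 2 * S) / (1 + S)) := by field_simp
        rw [this]
        have h3 : (1 - m) ^ 2 ≤ (1 + (1 - m) ^ 2 * S) / (1 + S) := by
          rw [le_div_iff₀ (by positivity)]
          nlinarith
        have := mul_le_mul_of_nonneg_left h3 (show 0 ≤ m * S by positivity)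
        nlinarith
      refine h1.trans ?_
      rw [div_le_iff₀ (by linarith)]
      nlinarith [mul_pos hm0 hm0]
    have h2 := mul_le_mul_of_nonneg_left hδ ht₀.1
    have h3 := mul_le_mul_of_nonneg_left hu (sq_nonneg t₀)
    have ht2 : t₀ ^ 2 ≤ 1 := pow_le_one₀ ht₀.1 ht₀.2
    have h4 : t₀ * (m * m) ≤ 1 * (m * m) := by
      have := ht₀.2
      gcongr
    have h5 : t₀ ^ 2 * (m * m) ≤ 1 * (m * m) := by gcongr
    rw [← hdt]
    nlinarith

/-! ### Existence of good tilting parameters -/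

lemma log_choose_le {L k : ℕ} (hk : 1 ≤ k) (hkL : k ≤ L) :
    Real.log (L.choose k) ≤ L * ((k : ℝ) / L * (1 - Real.log ((k : ℝ) / L))) := by
  have hk0 : (0 : ℝ) < k := by exact_mod_cast hk
  have hL0 : (0 : ℝ) < L := by exact_mod_cast (by omega : 0 < L)
  have h1 : (L.choose k : ℝ) ≤ (L : ℝ) ^ k / k.factorial := Nat.choose_le_pow_div k L
  have h2 : (k : ℝ) ^ k / k.factorial ≤ Real.exp k := Real.pow_div_factorial_le_exp k hk0.le k
  have hf : (0 : ℝ) < k.factorial := by exact_mod_cast Nat.factorial_pos k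
  have h3 : (L.choose k : ℝ) ≤ ((L : ℝ) / k) ^ k * Real.exp k := by
    refine h1.trans ?_
    have : (L : ℝ) ^ k / k.factorial = ((L : ℝ) / k) ^ k * ((k : ℝ) ^ k / k.factorial) := by
      rw [div_pow]; field_simp
    rw [this]
    gcongr
  have hc : (0 : ℝ) < L.choose k := by exact_mod_cast Nat.choose_pos hkL
  have h4 := Real.log_le_log hc h3
  rw [Real.log_mul (by positivity) (Real.exp_pos _).ne', Real.log_exp, Real.log_pow,
    Real.log_div hL0.ne' hk0.ne'] at h4
  rw [Real.log_div hk0.ne' hL0.ne']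
  refine h4.trans (le_of_eq ?_)
  field_simp
  ring

lemma log_choose_le_symm {L k : ℕ} (hkL : k < L) :
    Real.log (L.choose k) ≤ L * ((1 - (k : ℝ) / L) * (1 - Real.log (1 - (k : ℝ) / L))) := by
  have hL0 : (0 : ℝ) < L := by exact_mod_cast (by omega : 0 < L)
  have h := log_choose_le (L := L) (k := L - k) (by omega) (by omega)
  rw [Nat.choose_symm hkL.le, Nat.cast_sub hkL.le] at h
  have e : 1 - (k : ℝ) / L = ((L : ℝ) - k) / L := by field_simp
  rwa [e]

/-- There are parameters in the two Chernoff bounds for a fraction `α` of wrong sections that make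
both exponents at least `h`; the first one is reduced by the entropy term `κ`. -/
def HasTilts (S α Δ κ h : ℝ) : Prop :=
  ∃ t l₁ l₂ : ℝ, l₁ ∈ Set.Icc (0 : ℝ) 1 ∧ 0 ≤ l₂ ∧ l₂ ^ 2 * (α ^ 2 * S / (1 + α ^ 2 * S)) < 1 ∧
    h + κ ≤ tiltExponent l₁ (capacityGap S α + α * Δ - t) (decorrelation S α) ∧
    h ≤ tiltExponent l₂ t (α ^ 2 * S / (1 + α ^ 2 * S))

/-- Relaxing the standard deviation to `α√S` makes the condition linear in `α`: a threshold
proportional to `αΔ` gives an exponent free of `α`. The choice `t = αΔ/2` produces the argument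
`Δ/(2√S)` in `hExponent`. -/
lemma exists_noise_tilt {S α x t : ℝ} (hS : 0 < S) (hα : 0 < α) (hx : 0 < x)
    (h : x * (α * √S) ≤ t) :
    ∃ l₂ : ℝ, 0 ≤ l₂ ∧ l₂ ^ 2 * (α ^ 2 * S / (1 + α ^ 2 * S)) < 1 ∧
      1 / 4 * gFun x ≤ tiltExponent l₂ t (α ^ 2 * S / (1 + α ^ 2 * S)) := by
  refine exists_tiltExponent_ge_gFun hx (by positivity) (le_trans ?_ h)
  refine mul_le_mul_of_nonneg_left ?_ hx.le
  rw [Real.sqrt_le_left (by positivity), mul_pow, Real.sq_sqrt hS.le]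
  exact div_le_self (by positivity) (by have : 0 ≤ α ^ 2 * S := by positivity
                                        linarith)

section Tilts

variable {S α Δ κ h : ℝ}

lemma exists_noise_tilt_half (hS : 0 < S) (hα : 0 < α) (hΔ : 0 < Δ)
    (hh : h ≤ 1 / 4 * gFun (Δ / (2 * √S))) :
    ∃ l₂ : ℝ, 0 ≤ l₂ ∧ l₂ ^ 2 * (α ^ 2 * S / (1 + α ^ 2 * S)) < 1 ∧
      h ≤ tiltExponent l₂ (α * Δ / 2) (α ^ 2 * S / (1 + α ^ 2 * S)) := by
  have hs := Real.sqrt_pos.2 hS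
  obtain ⟨l₂, h1, h2, h3⟩ := exists_noise_tilt (t := α * Δ / 2) hS hα
    (show 0 < Δ / (2 * √S) by positivity) (by field_simp; rfl)
  exact ⟨l₂, h1, h2, hh.trans h3⟩

lemma hasTilts_one (hS : 0 < S) (hΔ : 0 < Δ) (h1 : h ≤ Δ * wFun S)
    (h2 : h ≤ 1 / 4 * gFun (Δ / (2 * √S))) : HasTilts S 1 Δ 0 h := by
  obtain ⟨l₂, e1, e2, e3⟩ := exists_noise_tilt_half hS one_pos hΔ h2
  refine ⟨1 * Δ / 2, 1, l₂, by simp, e1, e2, ?_, e3⟩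
  have := wFun_le_sixteenth hS
  simp [tiltExponent, capacityGap, decorrelation, capacityFrac, capacity]
  nlinarith

/-- The case of a rate far below capacity, relative to the fraction of wrong sections. -/
lemma hasTilts_of_mul_le (hS : 0 < S) (hα : 0 < α) (hα1 : α < 1) (hΔ : 0 < Δ)
    (hΔC : Δ ≤ S / 2) (hκ : κ ≤ chernoffD1 (capacityGap S α) (decorrelation S α))
    (hbig : α * (wFun S * (2 * S * (1 + √S)) / (3 * S / (4 * (1 + S))) ^ 2) ≤ Δ)
    (h1 : h ≤ α * Δ * wFun S) : HasTilts S α Δ κ h := by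
  have hs := Real.sqrt_pos.2 hS
  have hsq := Real.sq_sqrt hS.le
  have hη0 : 0 < 3 * S / (4 * (1 + S)) := by positivity
  have hη1 : 3 * S / (4 * (1 + S)) < 1 := by rw [div_lt_one (by positivity)]; linarith
  have hw := wFun_le_tiltFloor_mul hS
  set η := 3 * S / (4 * (1 + S))
  have hx : 0 < η * Δ / √S := by positivity
  obtain ⟨l₂, e1, e2, e3⟩ := exists_noise_tilt (t := η * (α * Δ)) hS hα hx
    (by field_simp; rfl)
  obtain ⟨l, hl, hlD⟩ := exists_tiltExponent_eq_chernoffD1 (δ := capacityGap S α)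
    (decorrelation_lt_one hS hα.le) (decorrelation_nonneg hS hα.le hα1.le)
  obtain ⟨l₁, hl₁, hl₁D⟩ := exists_tiltExponent_add_ge (y := (1 - η) * (α * Δ)) hS hα.le hα1.le
    hl.1 hl.2 (by have : 0 ≤ 1 - η := by linarith
                  positivity)
  -- The whole exponent at capacity pays for `κ`; the remaining share `1 - η` of `αΔ`, at slope at
  -- least `tiltFloor S`, pays for `h`.
  refine ⟨η * (α * Δ), l₁, l₂, hl₁, e1, e2, ?_, ?_⟩
  · rw [show capacityGap S α + α * Δ - η * (α * Δ) = capacityGap S α + (1 - η) * (α * Δ) by ring]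
    refine le_trans ?_ hl₁D
    have : wFun S * (α * Δ) ≤ tiltFloor S * (1 - η) * (α * Δ) := by gcongr
    nlinarith
  · refine le_trans ?_ e3
    refine h1.trans ?_
    have hx1 : η * Δ / √S ≤ √S := by
      rw [div_le_iff₀ hs]
      nlinarith
    have hg := le_gFun hx.le
    have hg2 : 2 * (η * Δ / √S) ^ 2 / (1 + √S) ≤ gFun (η * Δ / √S) := by
      refine le_trans ?_ hg
      gcongr
    have e4 : 2 * (η * Δ / √S) ^ 2 / (1 + √S) = 2 * η ^ 2 * Δ ^ 2 / (S * (1 + √S)) := by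
      rw [div_pow, hsq]; field_simp
    have e5 : α * wFun S ≤ 1 / 4 * (2 * η ^ 2 * Δ / (S * (1 + √S))) := by
      rw [← mul_div_assoc, div_le_iff₀ (by positivity)] at hbig
      rw [← mul_div_assoc, le_div_iff₀ (by positivity)]
      nlinarith
    calc α * Δ * wFun S = (α * wFun S) * Δ := by ring
      _ ≤ 1 / 4 * (2 * η ^ 2 * Δ / (S * (1 + √S))) * Δ := by gcongr
      _ = 1 / 4 * (2 * η ^ 2 * Δ ^ 2 / (S * (1 + √S))) := by ring
      _ ≤ _ := by rw [← e4]; gcongr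

/-- The case in which the optimal tilting parameter is `1`. -/
lemma hasTilts_of_le_half (hS : 0 < S) (hα : 0 < α) (hα1 : α < 1) (hΔ : 0 < Δ)
    (hκ : κ ≤ chernoffD1 (capacityGap S α) (decorrelation S α))
    (hbig : 3 * (decorrelation S α * (1 + S / 4)) ≤ 4 * (α * Δ / 2))
    (h1 : h ≤ α * Δ * wFun S) (h2 : h ≤ 1 / 4 * gFun (Δ / (2 * √S))) :
    HasTilts S α Δ κ h := by
  have hu0 := decorrelation_nonneg hS hα.le hα1.le
  have hu1 := decorrelation_lt_one hS hα.le
  obtain ⟨l₂, e1, e2, e3⟩ := exists_noise_tilt_half hS hα hΔ h2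
  obtain ⟨l, hl, hlD⟩ := exists_tiltExponent_eq_chernoffD1 (δ := capacityGap S α) hu1 hu0
  -- By `hbig` the quadratic loss at tilt `1` is at most two thirds of `αΔ/2`. The exponent is
  -- therefore at least the gap plus `αΔ/6`, where the gap covers `κ` and `wFun S ≤ 1/16` covers
  -- `h`.
  refine ⟨α * Δ / 2, 1, l₂, by simp, e1, e2, ?_, e3⟩
  have hδ0 : 0 ≤ capacityGap S α := le_trans (by positivity) (capacityGap_ge hS hα.le hα1.le)
  have hle := tiltExponent_le (δ := capacityGap S α) (sq_mul_lt_one hl.1 hl.2 hu1 hu0)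
  have hge := le_tiltExponent (t := 1) (δ := capacityGap S α + α * Δ - α * Δ / 2)
    zero_le_one le_rfl hu1 hu0
  have hdiv := div_one_sub_decorrelation_le hS hα.le hα1.le
  have hw := wFun_le_sixteenth hS
  have h3 : l * capacityGap S α ≤ 1 * capacityGap S α := by
    have := hl.2
    gcongr
  have h4 : 0 ≤ l ^ 2 * decorrelation S α := by positivity
  have h5 : α * Δ * wFun S ≤ α * Δ * (1 / 16) := by gcongr
  have h6 : 0 < α * Δ := by positivity
  linarith

/-- The case of a small entropy term. -/
lemma hasTilts_of_entropy_le (hS : 0 < S) (hα : 0 < α) (hα1 : α < 1) (hΔ : 0 < Δ)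
    (hsmall : 4 * (α * Δ / 2) < 3 * (decorrelation S α * (1 + S / 4)))
    (hκ1 : κ ≤ (tiltFloor S - wFun S) * (S / (4 * (1 + S))) * decorrelation S α)
    (hκ2 : κ ≤ (S / (4 * (1 + S))) ^ 2 / (8 * (1 + S / 4)) * decorrelation S α)
    (h1 : h ≤ α * Δ * wFun S) (h2 : h ≤ 1 / 4 * gFun (Δ / (2 * √S))) :
    HasTilts S α Δ κ h := by
  have hu := decorrelation_pos hS hα hα1
  have hu1 := decorrelation_lt_one hS hα.le
  obtain ⟨l₂, e1, e2, e3⟩ := exists_noise_tilt_half hS hα hΔ h2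
  have hδ := capacityGap_ge hS hα.le hα1.le
  have hdiv := div_one_sub_decorrelation_le hS hα.le hα1.le
  have hr1 : S / (4 * (1 + S)) ≤ 1 / 4 := by
    rw [div_le_div_iff₀ (by positivity) (by positivity)]; linarith
  have hr0 : 0 < S / (4 * (1 + S)) := by positivity
  have hfl : tiltFloor S = S / (4 * (1 + S)) / (1 + S / 4) := by
    unfold tiltFloor; field_simp
  have hwf := wFun_lt_tiltFloor hS
  set u := decorrelation S α
  set r := S / (4 * (1 + S))
  set y := α * Δ / 2 with hy
  have hy0 : 0 < y := by positivity
  set B := 1 + S / 4 with hB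
  have hB1 : 1 ≤ B := by rw [hB]; linarith
  have hl0 : 0 ≤ (r * u + y) / (u * B) := by positivity
  have hl1 : (r * u + y) / (u * B) ≤ 1 := by
    rw [div_le_one (by positivity)]
    nlinarith [mul_le_mul_of_nonneg_left hB1 hu.le]
  -- This tilt maximizes the parabola `l (r u + y) - l² B u / 2`; `hsmall` keeps it below `1`. The
  -- maximum is `2 (r/B) y + (r u - y)²/(2uB)` with `r/B = tiltFloor S`. For `y ≥ r u / 2` the
  -- linear surplus over `2 wFun S y` absorbs `κ`, otherwise the square does.
  refine ⟨y, (r * u + y) / (u * B), l₂, ⟨hl0, hl1⟩, e1, e2, ?_, e3⟩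
  have hge := le_tiltExponent (δ := capacityGap S α + α * Δ - y) hl0 hl1 hu1 hu.le
  refine le_trans ?_ hge
  set l := (r * u + y) / (u * B) with hl
  have a1 : l * (r * u + y) ≤ l * (capacityGap S α + α * Δ - y) := by
    refine mul_le_mul_of_nonneg_left ?_ hl0
    rw [hy]; linarith
  have a2 : l ^ 2 * (u / (1 - u)) ≤ l ^ 2 * (B * u) := by gcongr
  have a3 : l * (r * u + y) - 1 / 2 * (l ^ 2 * (B * u))
      = 2 * (r / B) * y + (r * u - y) ^ 2 / (2 * (u * B)) := by
    rw [hl]; field_simp; ring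
  have a4 : h ≤ 2 * wFun S * y := by rw [hy]; linarith
  rw [← hfl] at a3
  rcases le_or_gt (r * u / 2) y with hc | hc
  · have b1 : (tiltFloor S - wFun S) * (r * u) ≤ (tiltFloor S - wFun S) * (2 * y) := by
      refine mul_le_mul_of_nonneg_left (by linarith) (by linarith)
    have b2 : 0 ≤ (r * u - y) ^ 2 / (2 * (u * B)) := by positivity
    linarith
  · have b1 : r ^ 2 / (8 * B) * u ≤ (r * u - y) ^ 2 / (2 * (u * B)) := by
      have : r ^ 2 / (8 * B) * u = (r * u / 2) ^ 2 / (2 * (u * B)) := by field_simp; ring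
      rw [this]
      gcongr
      linarith
    have b2 : 0 ≤ (tiltFloor S - wFun S) * y := mul_nonneg (by linarith) hy0.le
    linarith

/-- The case of few or almost all wrong sections, at a rate close to capacity. -/
lemma hasTilts_of_expansion {m d Q t₀ D : ℝ} (hS : 0 < S) (hα : 0 < α) (hΔ : 0 < Δ)
    (hm : 0 < m) (ht₀ : t₀ ∈ Set.Icc (0 : ℝ) 1)
    (hlow : m * (d - Q * m) ≤ tiltExponent t₀ (capacityGap S α) (decorrelation S α))
    (hκ : κ ≤ m * (d / 2)) (hQm : Q * m ≤ d / 4) (hDm : D ^ 2 * m ≤ 2 * S * d)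
    (hΔm : Δ ≤ D * m) (h2 : h ≤ 1 / 4 * gFun (Δ / (2 * √S))) :
    HasTilts S α Δ κ h := by
  obtain ⟨l₂, e1, e2, e3⟩ := exists_noise_tilt_half hS hα hΔ h2
  -- The gain from `αΔ` is ignored: at capacity the exponent exceeds `κ` by at least `m d / 4`,
  -- while `h ≤ Δ²/(8S) ≤ D² m²/(8S) ≤ m d / 4`.
  refine ⟨α * Δ / 2, t₀, l₂, ht₀, e1, e2, ?_, e3⟩
  have hmono := tiltExponent_mono (u := decorrelation S α) ht₀.1
    (show capacityGap S α ≤ capacityGap S α + α * Δ - α * Δ / 2 by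
      have : 0 < α * Δ := by positivity
      linarith)
  have hg := gFun_le (Δ / (2 * √S))
  rw [div_pow, mul_pow, Real.sq_sqrt hS.le] at hg
  have hd : Δ ^ 2 ≤ (D * m) ^ 2 := by gcongr
  have h3 : 1 / 4 * (2 * (Δ ^ 2 / (2 ^ 2 * S))) ≤ m * (d / 4) := by
    have : 1 / 4 * (2 * (Δ ^ 2 / (2 ^ 2 * S))) = Δ ^ 2 / (8 * S) := by field_simp; ring
    rw [this, div_le_iff₀ (by positivity)]
    nlinarith
  nlinarith

end Tilts

/-- The entropy terms of a code with `M = L ^ a`, `a ≥ a*_L`, are dominated by the exponents at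
capacity. -/
def EntropyDominated (S : ℝ) (L : ℕ) (n : ℝ) : Prop :=
  ∀ k : ℕ, 1 ≤ k → k + 1 ≤ L → Real.log (L.choose k) ≤
    n * chernoffD1 (capacityGap S ((k : ℝ) / L)) (decorrelation S ((k : ℝ) / L))

lemma chernoffD1_capacityGap_le {S α : ℝ} (hS : 0 < S) (h0 : 0 ≤ α) (h1 : α ≤ 1) :
    chernoffD1 (capacityGap S α) (decorrelation S α) ≤ α * S / 2 := by
  have hu0 := decorrelation_nonneg hS h0 h1
  have hu1 := decorrelation_lt_one hS h0
  obtain ⟨l, hl, hlD⟩ := exists_tiltExponent_eq_chernoffD1 (δ := capacityGap S α) hu1 hu0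
  have hle := tiltExponent_le (δ := capacityGap S α) (sq_mul_lt_one hl.1 hl.2 hu1 hu0)
  have h2 : 0 ≤ l ^ 2 * decorrelation S α := by positivity
  have h3 := capacityFrac_le hS h0
  have h4 : 0 ≤ α * capacity S := mul_nonneg h0 (capacity_nonneg hS)
  have h5 : capacityGap S α ≤ α * S / 2 := by unfold capacityGap; linarith
  have h6 : l * capacityGap S α ≤ l * (α * S / 2) := mul_le_mul_of_nonneg_left h5 hl.1
  have h7 : l * (α * S / 2) ≤ 1 * (α * S / 2) := by
    have := hl.2
    gcongr
  rw [hlD]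
  linarith

/-- The case `k = 1`, combined with an exponent of at most `S/(2L)` at `α = 1/L`. -/
lemma EntropyDominated.mul_log_le {S n : ℝ} {L : ℕ} (hS : 0 < S) (hn : 0 < n) (hL : 2 ≤ L)
    (h : EntropyDominated S L n) : 2 * L * Real.log L ≤ n * S := by
  have hL0 : (0 : ℝ) < L := by exact_mod_cast (by omega : 0 < L)
  have h1 := h 1 le_rfl hL
  have h2 := chernoffD1_capacityGap_le (α := ((1 : ℕ) : ℝ) / L) hS (by positivity)
    (by rw [div_le_one hL0]; exact_mod_cast (by omega : 1 ≤ L))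
  have h3 := h1.trans (mul_le_mul_of_nonneg_left h2 hn.le)
  rw [Nat.choose_one_right, Nat.cast_one] at h3
  have h4 : n * (1 / (L : ℝ) * S / 2) = n * S / (2 * L) := by field_simp
  rw [h4, le_div_iff₀ (by positivity)] at h3
  linarith

set_option maxHeartbeats 1000000 in
/-- For blocks of length at least of order `L log L` and exponents at least of order `1 / √L`,
good tilting parameters exist for every fraction of wrong sections. -/
theorem exists_hasTilts {S : ℝ} (hS : 0 < S) :
    ∃ K > 0, ∃ L₀ : ℕ, ∀ (L l : ℕ) (n R h : ℝ), 0 < n → L₀ ≤ L → 2 ≤ L → 1 ≤ l → l ≤ L → 0 ≤ R →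
      R < capacity S → EntropyDominated S L n →
      h ≤ (l : ℝ) / L * (capacity S - R) * wFun S →
      h ≤ 1 / 4 * gFun ((capacity S - R) / (2 * √S)) → K / √(L : ℝ) ≤ h →
      HasTilts S ((l : ℝ) / L) (capacity S - R) (Real.log (L.choose l) / n) h := by
  obtain ⟨d₀, hd₀, Q₀, hQ₀, t₀, ht₀, hexp₀⟩ := tiltExponent_expansion_zero hS
  obtain ⟨d₁, hd₁, Q₁, hQ₁, t₁, ht₁, hexp₁⟩ := tiltExponent_expansion_one hS
  -- Failure of `hasTilts_of_mul_le` bounds `Δ` by the first constant times `α`; failure of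
  -- `hasTilts_of_le_half` bounds it by the second times `1 - α`.
  set D := max (wFun S * (2 * S * (1 + √S)) / (3 * S / (4 * (1 + S))) ^ 2)
    (2 * (S * (1 + S / 4))) with hD
  have hD0 : 0 < D := lt_of_lt_of_le (by positivity) (le_max_right _ _)
  obtain ⟨m₀, hm₀, hm₀Q, hm₀D⟩ : ∃ m₀ > 0, (Q₀ * m₀ ≤ d₀ / 4 ∧ Q₁ * m₀ ≤ d₁ / 4) ∧
      (D ^ 2 * m₀ ≤ 2 * S * d₀ ∧ D ^ 2 * m₀ ≤ 2 * S * d₁) := by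
    have key : ∀ A b : ℝ, 0 ≤ A → 0 < b → ∀ x : ℝ, 0 ≤ x → x ≤ b / (A + 1) → A * x ≤ b := by
      intro A b hA hb x hx0 hx
      rw [le_div_iff₀ (by linarith)] at hx
      linarith
    refine ⟨min (min (d₀ / 4 / (Q₀ + 1)) (d₁ / 4 / (Q₁ + 1)))
      (min (2 * S * d₀ / (D ^ 2 + 1)) (2 * S * d₁ / (D ^ 2 + 1))), by positivity,
      ⟨key _ _ hQ₀ (by positivity) _ (by positivity) ?_,
        key _ _ hQ₁ (by positivity) _ (by positivity) ?_⟩,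
      key _ _ (by positivity) (by positivity) _ (by positivity) ?_,
        key _ _ (by positivity) (by positivity) _ (by positivity) ?_⟩
    · exact (min_le_left _ _).trans (min_le_left _ _)
    · exact (min_le_left _ _).trans (min_le_right _ _)
    · exact (min_le_right _ _).trans (min_le_left _ _)
    · exact (min_le_right _ _).trans (min_le_right _ _)
  set c := min ((tiltFloor S - wFun S) * (S / (4 * (1 + S))))
    ((S / (4 * (1 + S))) ^ 2 / (8 * (1 + S / 4))) with hc
  have hc0 : 0 < c := by
    have := wFun_lt_tiltFloor hS
    refine lt_min (mul_pos (by linarith) (by positivity)) (by positivity)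
  have hev : ∀ᶠ L : ℕ in atTop, (Q₀ / L ≤ d₀ ∧ Q₁ / L ≤ d₁) ∧
      (1 - Real.log m₀) * (1 + S) / c ≤ Real.log L := by
    have hcast := tendsto_natCast_atTop_atTop (R := ℝ)
    refine ((hcast.const_div_atTop Q₀ |>.eventually_le_const hd₀).and
      (hcast.const_div_atTop Q₁ |>.eventually_le_const hd₁)).and ?_
    exact (Real.tendsto_log_atTop.comp hcast).eventually_ge_atTop _
  obtain ⟨L₀, hL₀⟩ := eventually_atTop.1 hev
  -- With this `K`, the chain `K/√L ≤ h ≤ Δ²/(8S) ≤ (Dm)²/(8S)` becomes `m² ≥ e²/√L`, that is `1 -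
  -- log m ≤ 1/4 log L`.
  refine ⟨Real.exp 1 ^ 2 * D ^ 2 / (8 * S), by positivity, L₀, ?_⟩
  intro L l n R h hn hLL hL2 hl1 hlL hR hRC hent h1 h2 hK
  obtain ⟨⟨hQL₀, hQL₁⟩, hlogL⟩ := hL₀ L hLL
  have hL0 : (0 : ℝ) < L := by exact_mod_cast (by omega : 0 < L)
  have hnL := hent.mul_log_le hS hn hL2
  have hΔ : 0 < capacity S - R := by linarith
  have hΔC : capacity S - R ≤ S / 2 := by linarith [capacity_le hS]
  set Δ := capacity S - R
  rcases hlL.eq_or_lt with rfl | hlt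
  · have e : (l : ℝ) / l = 1 := div_self hL0.ne'
    rw [e] at h1 ⊢
    rw [Nat.choose_self, Nat.cast_one, Real.log_one, zero_div]
    exact hasTilts_one hS hΔ (by linarith) h2
  have hl0 : (0 : ℝ) < l := by exact_mod_cast hl1
  have hα : 0 < (l : ℝ) / L := by positivity
  have hα1 : (l : ℝ) / L < 1 := by rw [div_lt_one hL0]; exact_mod_cast hlt
  have hκ : Real.log (L.choose l) / n ≤
      chernoffD1 (capacityGap S ((l : ℝ) / L)) (decorrelation S ((l : ℝ) / L)) := by
    rw [div_le_iff₀ hn]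
    linarith [hent l hl1 hlt]
  have hch1 := log_choose_le hl1 hlL
  have hch2 := log_choose_le_symm hlt
  set α := (l : ℝ) / L
  rcases le_or_gt (α * (wFun S * (2 * S * (1 + √S)) / (3 * S / (4 * (1 + S))) ^ 2)) Δ
    with hI | hI
  · exact hasTilts_of_mul_le hS hα hα1 hΔ hΔC hκ hI h1
  rcases le_or_gt (3 * (decorrelation S α * (1 + S / 4))) (4 * (α * Δ / 2)) with hII | hII
  · exact hasTilts_of_le_half hS hα hα1 hΔ hκ hII h1 h2
  have hΔα : Δ ≤ D * α := by
    have : wFun S * (2 * S * (1 + √S)) / (3 * S / (4 * (1 + S))) ^ 2 ≤ D := le_max_left _ _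
    nlinarith
  have hΔα' : Δ ≤ D * (1 - α) := by
    have hu : decorrelation S α ≤ α * (1 - α) * S := by
      unfold decorrelation
      have : 0 ≤ 1 - α := by linarith
      exact div_le_self (by positivity) (by have : 0 ≤ α * S := by positivity
                                            linarith)
    have h3 : α * (2 * Δ) ≤ α * (3 * ((1 - α) * S * (1 + S / 4))) := by
      have := mul_le_mul_of_nonneg_right hu (show 0 ≤ 1 + S / 4 by linarith)
      linarith
    have h4 := le_of_mul_le_mul_left h3 hα
    have h5 : 2 * (S * (1 + S / 4)) ≤ D := le_max_right _ _
    have h6 := mul_le_mul_of_nonneg_right h5 (show 0 ≤ 1 - α by linarith)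
    have h7 : 0 ≤ (1 - α) * S * (1 + S / 4) :=
      mul_nonneg (mul_nonneg (by linarith) hS.le) (by linarith)
    linarith
  have hlog : ∀ m : ℝ, 0 < m → Δ ≤ D * m → 1 - Real.log m ≤ 1 / 4 * Real.log L := by
    intro m hm hΔm
    have hg := gFun_le (Δ / (2 * √S))
    rw [div_pow, mul_pow, Real.sq_sqrt hS.le] at hg
    have e1 : Real.exp 1 ^ 2 * D ^ 2 / (8 * S) / √(L : ℝ) ≤ (D * m) ^ 2 / (8 * S) := by
      refine hK.trans (h2.trans ?_)
      have : (D * m) ^ 2 / (8 * S) = 1 / 4 * (2 * ((D * m) ^ 2 / (2 ^ 2 * S))) := by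
        field_simp; ring
      rw [this]
      refine mul_le_mul_of_nonneg_left (hg.trans ?_) (by norm_num)
      gcongr
    have e2 : Real.exp 1 ^ 2 / √(L : ℝ) ≤ m ^ 2 := by
      have hp : 0 < D ^ 2 / (8 * S) := by positivity
      refine le_of_mul_le_mul_left ?_ hp
      calc D ^ 2 / (8 * S) * (Real.exp 1 ^ 2 / √(L : ℝ))
          = Real.exp 1 ^ 2 * D ^ 2 / (8 * S) / √(L : ℝ) := by field_simp
        _ ≤ (D * m) ^ 2 / (8 * S) := e1
        _ = _ := by ring
    have e3 := Real.log_le_log (by positivity) e2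
    rw [Real.log_div (by positivity) (by positivity), Real.log_pow, Real.log_exp,
      Real.log_sqrt hL0.le, Real.log_pow] at e3
    push_cast at e3
    linarith
  have hpair : ∃ m : ℝ, 0 < m ∧ m ≤ 1 / 2 ∧ Δ ≤ D * m ∧ m * (1 / 2) ≤ α * (1 - α) ∧
      Real.log (L.choose l) ≤ L * (m * (1 - Real.log m)) ∧
      ((m = α) ∨ (m = 1 - α)) := by
    rcases le_or_gt α (1 / 2) with hh | hh
    · exact ⟨α, hα, hh, hΔα, mul_le_mul_of_nonneg_left (by linarith) hα.le, hch1, Or.inl rfl⟩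
    · exact ⟨1 - α, by linarith, by linarith, hΔα', by
        rw [mul_comm α]
        exact mul_le_mul_of_nonneg_left (by linarith) (by linarith), hch2, Or.inr rfl⟩
  obtain ⟨m, hm, hm2, hΔm, hmα, hch, hcase⟩ := hpair
  have hlm := hlog m hm hΔm
  rcases le_or_gt m m₀ with hmm | hmm
  · have hinv : (1 : ℝ) / L ≤ 1 / 2 := by
      apply one_div_le_one_div_of_le (by norm_num)
      exact_mod_cast hL2
    -- The entropy is at most `L m (log L)/4`. The extreme case `k = 1` or `k = L - 1` bounds `log
    -- L` by `n (d + Q/L)/L ≤ 2nd/L`, so at most half of the first-order exponent `m d` is spent.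
    have hend : ∀ d Q : ℝ, Q / L ≤ d → Real.log L ≤ n * (1 / L * (d + Q * (1 / L))) →
        Real.log (L.choose l) / n ≤ m * (d / 2) := by
      intro d Q hQ hlog
      rw [div_le_iff₀ hn]
      have f1 : (L : ℝ) * (m * (1 - Real.log m)) ≤ L * (m * (1 / 4 * Real.log L)) := by gcongr
      have f2 : L * (m * (1 / 4 * Real.log L))
          ≤ L * (m * (1 / 4 * (n * (1 / L * (d + Q * (1 / L)))))) := by gcongr
      have f3 : (L : ℝ) * (m * (1 / 4 * (n * (1 / L * (d + Q * (1 / L))))))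
          = m * (1 / 4 * (n * (d + Q / L))) := by field_simp
      have f4 : m * (1 / 4 * (n * (d + Q / L))) ≤ m * (1 / 4 * (n * (d + d))) := by gcongr
      linarith
    rcases hcase with rfl | hcase
    · refine hasTilts_of_expansion hS hα hΔ hm ht₀ (hexp₀ α hm hm2).2 (hend d₀ Q₀ hQL₀ ?_) ?_ ?_
        hΔm h2
      · have g1 := hent 1 le_rfl hL2
        rw [Nat.choose_one_right, Nat.cast_one] at g1
        refine g1.trans (mul_le_mul_of_nonneg_left ?_ hn.le)
        obtain ⟨t, ht, hD⟩ := exists_tiltExponent_eq_chernoffD1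
          (δ := capacityGap S (1 / L)) (u := decorrelation S (1 / L))
          (decorrelation_lt_one hS (by positivity))
          (decorrelation_nonneg hS (by positivity) (by linarith))
        rw [hD]
        exact (hexp₀ (1 / L) (by positivity) hinv).1 t ht
      · exact (mul_le_mul_of_nonneg_left hmm hQ₀).trans hm₀Q.1
      · exact (mul_le_mul_of_nonneg_left hmm (by positivity)).trans hm₀D.1
    · have hαm : α = 1 - m := by linarith
      refine hasTilts_of_expansion hS hα hΔ hm ht₁ (hαm ▸ (hexp₁ m hm hm2).2)
        (hend d₁ Q₁ hQL₁ ?_) ?_ ?_ hΔm h2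
      · have g1 := hent (L - 1) (by omega) (by omega)
        rw [Nat.choose_symm (by omega : 1 ≤ L), Nat.choose_one_right,
          Nat.cast_sub (by omega : 1 ≤ L), Nat.cast_one,
          show ((L : ℝ) - 1) / L = 1 - 1 / L by field_simp] at g1
        refine g1.trans (mul_le_mul_of_nonneg_left ?_ hn.le)
        obtain ⟨t, ht, hD⟩ := exists_tiltExponent_eq_chernoffD1
          (δ := capacityGap S (1 - 1 / L)) (u := decorrelation S (1 - 1 / L))
          (decorrelation_lt_one hS (by linarith))
          (decorrelation_nonneg hS (by linarith) (by linarith [show (0 : ℝ) < 1 / L by positivity]))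
        rw [hD]
        exact (hexp₁ (1 / L) (by positivity) hinv).1 t ht
      · exact (mul_le_mul_of_nonneg_left hmm hQ₁).trans hm₀Q.2
      · exact (mul_le_mul_of_nonneg_left hmm (by positivity)).trans hm₀D.2
  -- Away from both ends the entropy is `O(L)`, whereas `n` is at least of order `L log L`; the
  -- quotient falls below any fixed multiple of the decorrelation for large `L`.
  · have hκc : Real.log (L.choose l) / n ≤ c * decorrelation S α := by
      rw [div_le_iff₀ hn]
      have f1 : Real.log m₀ ≤ Real.log m := Real.log_le_log hm₀ hmm.le
      rw [div_le_iff₀ hc0] at hlogL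
      have f2 : m * S / (2 * (1 + S)) ≤ decorrelation S α := by
        unfold decorrelation
        rw [div_le_div_iff₀ (by positivity) (by positivity)]
        have f3 : 1 + α * S ≤ 1 + S := by nlinarith
        calc m * S * (1 + α * S) ≤ m * S * (1 + S) := by gcongr
          _ = m * (1 / 2) * (S * (2 * (1 + S))) := by ring
          _ ≤ α * (1 - α) * (S * (2 * (1 + S))) := by gcongr
          _ = _ := by ring
      have f4 : (L : ℝ) * (m * (1 - Real.log m)) * (1 + S) ≤ L * m * (Real.log L * c) := by
        have : (1 - Real.log m) * (1 + S) ≤ (1 - Real.log m₀) * (1 + S) := by gcongr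
        calc (L : ℝ) * (m * (1 - Real.log m)) * (1 + S)
            = L * m * ((1 - Real.log m) * (1 + S)) := by ring
          _ ≤ L * m * (Real.log L * c) := by
            refine mul_le_mul_of_nonneg_left (this.trans hlogL) (by positivity)
      calc Real.log (L.choose l) ≤ L * (m * (1 - Real.log m)) := hch
        _ ≤ L * m * (Real.log L * c) / (1 + S) := by rw [le_div_iff₀ (by positivity)]; exact f4
        _ = (2 * L * Real.log L) * (m * c / (2 * (1 + S))) := by field_simp
        _ ≤ (n * S) * (m * c / (2 * (1 + S))) := by gcongr
        _ = c * (m * S / (2 * (1 + S))) * n := by field_simp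
        _ ≤ c * decorrelation S α * n := by gcongr
    have hu0 := decorrelation_nonneg hS hα.le hα1.le
    refine hasTilts_of_entropy_le hS hα hα1 hΔ hII (hκc.trans ?_) (hκc.trans ?_) h1 h2
    · exact mul_le_mul_of_nonneg_right (min_le_left _ _) hu0
    · exact mul_le_mul_of_nonneg_right (min_le_right _ _) hu0

/-! ### Gaussian and Rademacher integrals of exponentials of quadratic functions -/

/-- `exp x` as an extended nonnegative real. -/
def eexp (x : ℝ) : ℝ≥0∞ := ENNReal.ofReal (Real.exp x)

lemma eexp_add (x y : ℝ) : eexp (x + y) = eexp x * eexp y := by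
  unfold eexp
  rw [Real.exp_add, ENNReal.ofReal_mul (Real.exp_pos x).le]

lemma eexp_zero : eexp 0 = 1 := by simp [eexp]

lemma eexp_mono {x y : ℝ} (h : x ≤ y) : eexp x ≤ eexp y :=
  ENNReal.ofReal_le_ofReal (Real.exp_le_exp.2 h)

lemma eexp_ne_top (x : ℝ) : eexp x ≠ ∞ := ENNReal.ofReal_ne_top

lemma one_le_eexp {x : ℝ} (h : 0 ≤ x) : 1 ≤ eexp x := eexp_zero ▸ eexp_mono h

lemma eexp_sum {ι : Type*} (s : Finset ι) (f : ι → ℝ) : eexp (∑ i ∈ s, f i) = ∏ i ∈ s, eexp (f i) := by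
  unfold eexp
  rw [Real.exp_sum, ENNReal.ofReal_prod_of_nonneg fun i _ => (Real.exp_pos _).le]

lemma eexp_pow (x : ℝ) (n : ℕ) : eexp x ^ n = eexp (n * x) := by
  unfold eexp
  rw [← ENNReal.ofReal_pow (Real.exp_pos x).le, ← Real.exp_nat_mul]

@[fun_prop]
lemma measurable_eexp : Measurable eexp := by unfold eexp; fun_prop

lemma lintegral_gaussian_quadratic {σ κ : ℝ} (β : ℝ) (hσ : 0 < σ) (hκ : -1 < κ) :
    ∫⁻ w, eexp (-(1 / 2) * κ * (w / σ) ^ 2 + β * (w / σ)) ∂gaussianReal 0 (Real.toNNReal (σ ^ 2))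
      = eexp (-(1 / 2) * Real.log (1 + κ) + 1 / 2 * β ^ 2 / (1 + κ)) := by
  have hκ1 : 0 < 1 + κ := by linarith
  have hv : Real.toNNReal (σ ^ 2) ≠ 0 := by simp; positivity
  have hv' : Real.toNNReal (σ ^ 2 / (1 + κ)) ≠ 0 := by simp; positivity
  rw [gaussianReal_of_var_ne_zero _ hv, lintegral_withDensity_eq_lintegral_mul _ (by fun_prop)
    (by fun_prop)]
  have key : ∀ w : ℝ, (gaussianPDF 0 (Real.toNNReal (σ ^ 2)) * fun w =>
      eexp (-(1 / 2) * κ * (w / σ) ^ 2 + β * (w / σ))) w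
      = eexp (-(1 / 2) * Real.log (1 + κ) + 1 / 2 * β ^ 2 / (1 + κ))
        * gaussianPDF (β * σ / (1 + κ)) (Real.toNNReal (σ ^ 2 / (1 + κ))) w := by
    intro w
    simp only [Pi.mul_apply, gaussianPDF, eexp]
    rw [← ENNReal.ofReal_mul (gaussianPDFReal_nonneg _ _ _),
      ← ENNReal.ofReal_mul (Real.exp_pos _).le]
    congr 1
    simp only [gaussianPDFReal, Real.coe_toNNReal _ (show 0 ≤ σ ^ 2 by positivity),
      Real.coe_toNNReal _ (show 0 ≤ σ ^ 2 / (1 + κ) by positivity)]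
    have e1 : √(2 * Real.pi * (σ ^ 2 / (1 + κ))) = √(2 * Real.pi * σ ^ 2) / √(1 + κ) := by
      rw [← Real.sqrt_div (by positivity), mul_div_assoc]
    have e2 : Real.exp (-(1 / 2) * Real.log (1 + κ) + 1 / 2 * β ^ 2 / (1 + κ))
        = (√(1 + κ))⁻¹ * Real.exp (1 / 2 * β ^ 2 / (1 + κ)) := by
      rw [Real.exp_add]
      congr 1
      rw [show -(1 / 2) * Real.log (1 + κ) = -(Real.log (1 + κ) / 2) by ring,
        ← Real.log_sqrt hκ1.le, Real.exp_neg, Real.exp_log (Real.sqrt_pos.2 hκ1)]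
    have hs := Real.sqrt_pos.2 hκ1
    rw [e1, e2, mul_assoc, ← Real.exp_add]
    have e3 : -(w - 0) ^ 2 / (2 * σ ^ 2) + (-(1 / 2) * κ * (w / σ) ^ 2 + β * (w / σ))
        = 1 / 2 * β ^ 2 / (1 + κ)
          + -(w - β * σ / (1 + κ)) ^ 2 / (2 * (σ ^ 2 / (1 + κ))) := by
      field_simp; ring
    rw [e3, Real.exp_add]
    field_simp
  simp_rw [key]
  rw [lintegral_const_mul _ (by fun_prop), lintegral_gaussianPDF_eq_one _ hv', mul_one]

instance : IsProbabilityMeasure signMeasure :=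
  ⟨by simp [signMeasure, ENNReal.inv_two_add_inv_two]⟩

lemma lintegral_signMeasure {f : ℝ → ℝ≥0∞} (hf : Measurable f) :
    ∫⁻ x, f x ∂signMeasure = 2⁻¹ * f 1 + 2⁻¹ * f (-1) := by
  unfold signMeasure
  rw [lintegral_add_measure, lintegral_smul_measure, lintegral_smul_measure,
    lintegral_dirac' _ hf, lintegral_dirac' _ hf]
  rfl

lemma lintegral_indepFun {Ω β γ : Type*} [MeasurableSpace Ω] [MeasurableSpace β]
    [MeasurableSpace γ] {μ : Measure Ω} [IsProbabilityMeasure μ] {f : Ω → β} {g : Ω → γ}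
    (hf : Measurable f) (hg : Measurable g) (h : IndepFun f g μ) {F : β → γ → ℝ≥0∞}
    (hF : Measurable (Function.uncurry F)) :
    ∫⁻ ω, F (f ω) (g ω) ∂μ = ∫⁻ ω, ∫⁻ ω', F (f ω) (g ω') ∂μ ∂μ := by
  have h1 := (indepFun_iff_map_prod_eq_prod_map_map hf.aemeasurable hg.aemeasurable).1 h
  have h2 : ∫⁻ ω, F (f ω) (g ω) ∂μ
      = ∫⁻ p, Function.uncurry F p ∂(μ.map (fun ω => (f ω, g ω))) := by
    rw [lintegral_map hF (hf.prodMk hg)]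
    rfl
  have : IsProbabilityMeasure (μ.map f) := Measure.isProbabilityMeasure_map hf.aemeasurable
  have : IsProbabilityMeasure (μ.map g) := Measure.isProbabilityMeasure_map hg.aemeasurable
  rw [h2, h1, lintegral_prod _ hF.aemeasurable, lintegral_map (hF.lintegral_prod_right') hf]
  refine lintegral_congr fun ω => ?_
  exact lintegral_map (hF.comp measurable_prodMk_left) hg

/-- Apart from `3/4 B²`, the right side is the exact average over a Gaussian of variance `θ²`. It is
again the exponential of a quadratic in `y`, with `κ` and `β` divided by `1 + κθ²`, so the step can
be iterated. The factor `exp(-b/2)` becomes `(1+b)^(-1/2)` through `log (1+b) ≤ b`. -/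
lemma sign_step {κ β θ B y : ℝ} (hb : 0 < 1 + κ * θ ^ 2) (hB : κ * θ ^ 2 ≤ B) :
    ∫⁻ x, eexp (-(1 / 2) * κ * (y + θ * x) ^ 2 + β * (y + θ * x)) ∂signMeasure
      ≤ eexp ((3 / 4 * B ^ 2 - 1 / 2 * Real.log (1 + κ * θ ^ 2)
          + 1 / 2 * β ^ 2 * θ ^ 2 / (1 + κ * θ ^ 2))
        + (-(1 / 2) * (κ / (1 + κ * θ ^ 2)) * y ^ 2 + β / (1 + κ * θ ^ 2) * y)) := by
  rw [lintegral_signMeasure (by fun_prop)]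
  have h2 : (2⁻¹ : ℝ≥0∞) = ENNReal.ofReal (1 / 2) := by
    rw [one_div, ENNReal.ofReal_inv_of_pos (by norm_num)]; norm_num
  unfold eexp
  rw [h2, ← ENNReal.ofReal_mul (by norm_num), ← ENNReal.ofReal_mul (by norm_num),
    ← ENNReal.ofReal_add (by positivity) (by positivity)]
  refine ENNReal.ofReal_le_ofReal ?_
  set b := κ * θ ^ 2 with hbdef
  set s := θ * (β - κ * y) with hs
  have e1 : 1 / 2 * Real.exp (-(1 / 2) * κ * (y + θ * 1) ^ 2 + β * (y + θ * 1))
      + 1 / 2 * Real.exp (-(1 / 2) * κ * (y + θ * -1) ^ 2 + β * (y + θ * -1))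
      = Real.exp (-(1 / 2) * κ * y ^ 2 + β * y - b / 2) * Real.cosh s := by
    rw [Real.cosh_eq, show -(1 / 2) * κ * (y + θ * 1) ^ 2 + β * (y + θ * 1)
      = (-(1 / 2) * κ * y ^ 2 + β * y - b / 2) + s by rw [hbdef, hs]; ring,
      show -(1 / 2) * κ * (y + θ * -1) ^ 2 + β * (y + θ * -1)
      = (-(1 / 2) * κ * y ^ 2 + β * y - b / 2) + -s by rw [hbdef, hs]; ring,
      Real.exp_add, Real.exp_add]
    ring
  rw [e1]
  refine (mul_le_mul_of_nonneg_left (cosh_le_exp_div_add s (by linarith) hB)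
    (Real.exp_pos _).le).trans ?_
  rw [← Real.exp_add]
  refine Real.exp_le_exp.2 ?_
  have hl := Real.log_le_sub_one_of_pos hb
  have e2 : s ^ 2 / (2 * (1 + b)) = 1 / 2 * β ^ 2 * θ ^ 2 / (1 + b)
      + (-(1 / 2) * (κ / (1 + b)) * y ^ 2 + β / (1 + b) * y) - (-(1 / 2) * κ * y ^ 2 + β * y) := by
    rw [hs]
    field_simp
    rw [hbdef]
    ring
  rw [e2]
  linarith

section SignSums

variable {ι : Type*} [Fintype ι]

/-- Independent uniform signs indexed by `ι`. -/
def signs (ι : Type*) [Fintype ι] : Measure (ι → ℝ) := Measure.pi fun _ => signMeasure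

instance : IsProbabilityMeasure (signs ι) := by unfold signs; infer_instance

lemma iIndepFun_signs : iIndepFun (fun (i : ι) (a : ι → ℝ) => a i) (signs ι) :=
  iIndepFun_pi (X := fun _ => id) fun _ => aemeasurable_id

lemma lintegral_signs_eval (i : ι) {f : ℝ → ℝ≥0∞} (hf : Measurable f) :
    ∫⁻ a, f (a i) ∂signs ι = ∫⁻ x, f x ∂signMeasure := by
  have := (measurePreserving_eval (fun _ : ι => signMeasure) i).lintegral_comp hf
  exact this

/-- A sum of independent signs is dominated, up to a small factor, by a Gaussian of the same
variance in expectations of exponentials of quadratic functions. -/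
lemma lintegral_signs_quadratic_le [DecidableEq ι] (J : Finset ι) {θ B : ℝ} (hB0 : 0 ≤ B)
    (κ β : ℝ) (hκ : 0 < 1 + κ * (J.card * θ ^ 2)) (hB : κ * θ ^ 2 ≤ B) :
    ∫⁻ a, eexp (-(1 / 2) * κ * (θ * ∑ j ∈ J, a j) ^ 2 + β * (θ * ∑ j ∈ J, a j)) ∂signs ι
      ≤ eexp (3 / 4 * J.card * B ^ 2 - 1 / 2 * Real.log (1 + κ * (J.card * θ ^ 2))
          + 1 / 2 * β ^ 2 * (J.card * θ ^ 2) / (1 + κ * (J.card * θ ^ 2))) := by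
  induction J using Finset.induction_on generalizing κ β with
  | empty => simp [eexp_zero]
  | insert j J hj ih =>
    rw [Finset.card_insert_of_notMem hj] at hκ ⊢
    push_cast at hκ ⊢
    set k : ℝ := (J.card : ℝ) with hk
    have hk0 : 0 ≤ k := Nat.cast_nonneg _
    set b := κ * θ ^ 2 with hb
    have hκ' : 0 < 1 + (k + 1) * b := by rw [hb]; linarith
    have hb1 : 0 < 1 + b := by
      rcases le_or_gt 0 b with h | h
      · linarith
      · nlinarith
    have hind := iIndepFun_signs (ι := ι) |>.indepFun_finsetSum_of_notMem
      (fun i => measurable_pi_apply i) hj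
    have hF : Measurable (Function.uncurry fun (s x : ℝ) =>
        eexp (-(1 / 2) * κ * (θ * (x + s)) ^ 2 + β * (θ * (x + s)))) := by
      unfold Function.uncurry
      fun_prop
    have h1 := lintegral_indepFun (μ := signs ι) (by fun_prop) (by fun_prop) hind hF
    simp only [Finset.sum_apply] at h1
    simp_rw [Finset.sum_insert hj]
    rw [h1]
    have h2 : ∀ s : ℝ, ∫⁻ a, eexp (-(1 / 2) * κ * (θ * (a j + s)) ^ 2 + β * (θ * (a j + s)))
        ∂signs ι ≤ eexp (3 / 4 * B ^ 2 - 1 / 2 * Real.log (1 + b) + 1 / 2 * β ^ 2 * θ ^ 2 / (1 + b))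
          * eexp (-(1 / 2) * (κ / (1 + b)) * (θ * s) ^ 2 + β / (1 + b) * (θ * s)) := by
      intro s
      rw [lintegral_signs_eval j (f := fun x => eexp (-(1 / 2) * κ * (θ * (x + s)) ^ 2
        + β * (θ * (x + s)))) (by fun_prop), ← eexp_add]
      refine le_trans (le_of_eq ?_) (sign_step (y := θ * s) hb1 hB)
      refine lintegral_congr fun x => ?_
      congr 1
      ring
    refine (lintegral_mono fun a => h2 _).trans ?_
    rw [lintegral_const_mul _ (by fun_prop)]
    have hpos : 1 + κ / (1 + b) * (k * θ ^ 2) = (1 + (k + 1) * b) / (1 + b) := by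
      field_simp
      rw [hb]; ring
    -- The updated coefficient shrinks if it is nonnegative and stays negative otherwise, so one `B`
    -- serves all the signs.
    have hB' : κ / (1 + b) * θ ^ 2 ≤ B := by
      have : κ / (1 + b) * θ ^ 2 = b / (1 + b) := by rw [hb]; ring
      rw [this, div_le_iff₀ hb1]
      rcases le_or_gt 0 b with h | h
      · nlinarith
      · nlinarith [mul_nonneg hB0 hb1.le]
    have h3 := ih (κ / (1 + b)) (β / (1 + b)) (by rw [hpos]; positivity) hB'
    refine (mul_le_mul_right h3 _).trans ?_
    rw [← eexp_add, hpos, Real.log_div hκ'.ne' hb1.ne',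
      show κ * ((k + 1) * θ ^ 2) = (k + 1) * b by rw [hb]; ring]
    refine eexp_mono (le_of_eq ?_)
    have e : 1 / 2 * β ^ 2 * θ ^ 2 / (1 + b)
        + 1 / 2 * (β / (1 + b)) ^ 2 * (k * θ ^ 2) / ((1 + (k + 1) * b) / (1 + b))
        = 1 / 2 * β ^ 2 * ((k + 1) * θ ^ 2) / (1 + (k + 1) * b) := by
      have e' : 1 + (k + 1) * b + k = (k + 1) * (1 + b) := by ring
      generalize 1 + (k + 1) * b = d at hκ' e'
      field_simp
      linear_combination β ^ 2 * θ ^ 2 * e'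
    rw [← e]
    ring

end SignSums

/-! ### Factorization of integrals over independent rows -/

lemma lintegral_pi_fin_prod {E : Type*} [MeasurableSpace E] {μ : Measure E} [SigmaFinite μ]
    {n : ℕ} (f : Fin n → E → ℝ≥0∞) (hf : ∀ i, Measurable (f i)) :
    ∫⁻ x, ∏ i, f i (x i) ∂(Measure.pi fun _ : Fin n => μ) = ∏ i, ∫⁻ x, f i x ∂μ := by
  induction n with
  | zero => simp
  | succ n ih =>
    have hmp := (measurePreserving_piFinSuccAbove (fun _ : Fin (n + 1) => μ) 0).symm
    rw [← hmp.lintegral_comp (f := fun x : Fin (n + 1) → E => ∏ i, f i (x i))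
      (Finset.measurable_fun_prod _ fun i _ => (hf i).comp (measurable_pi_apply i))]
    simp_rw [Fin.prod_univ_succ]
    rw [← ih (fun i => f i.succ) (fun i => hf _), ← lintegral_prod_mul (hf 0).aemeasurable
      (Finset.measurable_fun_prod _ fun i _ => (hf i.succ).comp (measurable_pi_apply i)).aemeasurable]
    rfl

lemma lintegral_prod_pi_fin_pow {E E' : Type*} [MeasurableSpace E] [MeasurableSpace E']
    {μ : Measure E} {ν : Measure E'} [SigmaFinite μ] [SigmaFinite ν] (n : ℕ)
    {F : E → E' → ℝ≥0∞} (hF : Measurable (Function.uncurry F)) :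
    ∫⁻ q, ∏ i, F (q.1 i) (q.2 i)
        ∂((Measure.pi fun _ : Fin n => μ).prod (Measure.pi fun _ : Fin n => ν))
      = (∫⁻ x, ∫⁻ y, F x y ∂ν ∂μ) ^ n := by
  have hm : Measurable fun q : (Fin n → E) × (Fin n → E') => ∏ i, F (q.1 i) (q.2 i) := by
    refine Finset.measurable_fun_prod _ fun i _ => ?_
    have hp : Measurable fun q : (Fin n → E) × (Fin n → E') => (q.1 i, q.2 i) := by fun_prop
    exact hF.comp hp
  rw [lintegral_prod _ hm.aemeasurable]
  have h1 : ∀ x : Fin n → E, ∫⁻ y, ∏ i, F (x i) (y i) ∂(Measure.pi fun _ : Fin n => ν)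
      = ∏ i, ∫⁻ y, F (x i) y ∂ν := fun x =>
    lintegral_pi_fin_prod (fun i => F (x i)) fun i => hF.comp measurable_prodMk_left
  simp_rw [h1]
  rw [lintegral_pi_fin_prod (fun _ x => ∫⁻ y, F x y ∂ν) fun i => hF.lintegral_prod_right',
    Finset.prod_const, Finset.card_univ, Fintype.card_fin]

/-! ### Exponential moments for a single row -/

section Rows

variable {ι : Type*} [Fintype ι] [DecidableEq ι]

lemma indepFun_sum_pair {J₁ J₂ J₃ : Finset ι} (h₁ : Disjoint J₁ J₂) (h₃ : Disjoint J₃ J₂) :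
    IndepFun (fun a : ι → ℝ => (∑ j ∈ J₁, a j, ∑ j ∈ J₃, a j)) (fun a => ∑ j ∈ J₂, a j)
      (signs ι) := by
  have h := iIndepFun_signs (ι := ι) |>.indepFun_finset (J₁ ∪ J₃) J₂
    (Finset.disjoint_union_left.2 ⟨h₁, h₃⟩) (fun i => measurable_pi_apply i)
  have hs : ∀ (J T : Finset ι), J ⊆ T → ∀ a : ι → ℝ,
      ∑ j : T, (if (j : ι) ∈ J then a j else 0) = ∑ j ∈ J, a j := by
    intro J T hJT a
    rw [Finset.sum_coe_sort T (fun j => if j ∈ J then a j else 0), Finset.sum_ite_mem,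
      Finset.inter_eq_right.2 hJT]
  have hm : ∀ (J T : Finset ι),
      Measurable fun b : T → ℝ => ∑ j : T, (if (j : ι) ∈ J then b j else 0) := by
    intro J T
    refine Finset.measurable_fun_sum _ fun j _ => ?_
    by_cases hj : (j : ι) ∈ J
    · simpa [hj] using measurable_pi_apply j
    · simp [hj]
  have h2 := h.comp ((hm J₁ (J₁ ∪ J₃)).prodMk (hm J₃ (J₁ ∪ J₃))) (hm J₂ J₂)
  convert h2 using 1
  · funext a
    simp only [Function.comp]
    rw [hs J₁ _ Finset.subset_union_left, hs J₃ _ Finset.subset_union_right]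
  · funext a
    simp only [Function.comp]
    rw [hs J₂ _ subset_rfl]

/-- The difference of the two quadratic forms whose exponential moments govern the error
probability; `x₁`, `x₃` are the contributions of the correctly and wrongly decoded sections and `w`
is the noise. -/
def quadDiff (S α x₁ x₃ w : ℝ) : ℝ :=
  1 / 2 * ((w + α * (x₁ + x₃)) ^ 2 / (1 + α ^ 2 * S) - (w + x₃) ^ 2 / (1 + α * S))

variable {S α θ σ l : ℝ}

/-- Averaging over the contribution of the wrong alternatives. -/
lemma lintegral_alternative_le (hS : 0 < S) (hα : 0 < α) {J : Finset ι}
    (hJ : J.card * θ ^ 2 = α * S) (y : ℝ) :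
    ∫⁻ a, eexp (-(1 / 2) * (y - θ * ∑ j ∈ J, a j) ^ 2) ∂signs ι
      ≤ eexp (3 / 4 * (α * S) * θ ^ 2 - capacityFrac S α - 1 / 2 * y ^ 2 / (1 + α * S)) := by
  have h := lintegral_signs_quadratic_le J (θ := θ) (B := θ ^ 2) (sq_nonneg θ) 1 y
    (by rw [hJ]; positivity) (by rw [one_mul])
  rw [hJ] at h
  have e1 : ∀ a : ι → ℝ, eexp (-(1 / 2) * (y - θ * ∑ j ∈ J, a j) ^ 2) = eexp (-(1 / 2) * y ^ 2)
      * eexp (-(1 / 2) * 1 * (θ * ∑ j ∈ J, a j) ^ 2 + y * (θ * ∑ j ∈ J, a j)) := by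
    intro a
    rw [← eexp_add]
    congr 1
    ring
  simp_rw [e1]
  rw [lintegral_const_mul _ (by fun_prop)]
  refine (mul_le_mul_right h _).trans ?_
  rw [← eexp_add]
  refine eexp_mono (le_of_eq ?_)
  have : 0 < 1 + α * S := by positivity
  have e2 : 3 / 4 * (J.card : ℝ) * (θ ^ 2) ^ 2 = 3 / 4 * (α * S) * θ ^ 2 := by rw [← hJ]; ring
  rw [e2]
  unfold capacityFrac
  field_simp
  ring

/-- The exponential moment of `quadDiff` over one row of the dictionary and the noise. -/
lemma lintegral_quadDiff_le (hS : 0 < S) (hα : 0 < α) (hα1 : α ≤ 1) (hσ : 0 < σ) (hl0 : 0 ≤ l)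
    (hl1 : l ≤ 1) {J₁ J₃ : Finset ι} (hdis : Disjoint J₁ J₃) (hJ₁ : J₁.card * θ ^ 2 = (1 - α) * S)
    (hJ₃ : J₃.card * θ ^ 2 = α * S) :
    ∫⁻ a, ∫⁻ w, eexp (l * quadDiff S α (θ * ∑ j ∈ J₁, a j) (θ * ∑ j ∈ J₃, a j) (w / σ))
        ∂gaussianReal 0 (Real.toNNReal (σ ^ 2)) ∂signs ι
      ≤ eexp (3 / 4 * (α * S) * θ ^ 2 - 1 / 2 * Real.log (1 - l ^ 2 * decorrelation S α)) := by
  have hind : IndepFun (fun a : ι → ℝ => ∑ j ∈ J₃, a j) (fun a => ∑ j ∈ J₁, a j) (signs ι) :=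
    (indepFun_sum_pair hdis.symm hdis.symm).comp measurable_fst measurable_id
  have hu1 := sq_mul_lt_one hl0 hl1 (decorrelation_lt_one hS hα.le)
    (decorrelation_nonneg hS hα.le hα1)
  have hF : Measurable (Function.uncurry fun (x₃ x₁ : ℝ) => ∫⁻ w,
      eexp (l * quadDiff S α (θ * x₁) (θ * x₃) (w / σ))
        ∂gaussianReal 0 (Real.toNNReal (σ ^ 2))) := by
    refine Measurable.lintegral_prod_right' (f := fun z : (ℝ × ℝ) × ℝ =>
      eexp (l * quadDiff S α (θ * z.1.2) (θ * z.1.1) (z.2 / σ))) ?_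
    unfold quadDiff
    fun_prop
  have h1 := lintegral_indepFun (μ := signs ι) (by fun_prop) (by fun_prop) hind hF
  rw [h1]
  have hswap : ∀ x₃ : ℝ, ∫⁻ a, ∫⁻ w, eexp (l * quadDiff S α (θ * ∑ j ∈ J₁, a j) (θ * x₃) (w / σ))
        ∂gaussianReal 0 (Real.toNNReal (σ ^ 2)) ∂signs ι
      = ∫⁻ w, ∫⁻ a, eexp (l * quadDiff S α (θ * ∑ j ∈ J₁, a j) (θ * x₃) (w / σ)) ∂signs ι
        ∂gaussianReal 0 (Real.toNNReal (σ ^ 2)) := by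
    intro x₃
    refine lintegral_lintegral_swap ?_
    unfold quadDiff Function.uncurry
    fun_prop
  simp_rw [hswap]
  set p := 1 + α ^ 2 * S with hp
  set s := 1 + α * S with hs
  set m := p - l * α ^ 2 * ((1 - α) * S) with hm
  set N := m * s - l * s + l * m with hN
  have hp0 : 0 < p := by positivity
  have hs0 : 0 < s := by positivity
  have hm1 : 1 + α ^ 3 * S ≤ m := by
    have : 0 ≤ (1 - l) * (α ^ 2 * ((1 - α) * S)) := by
      have : 0 ≤ 1 - l := by linarith
      have : 0 ≤ 1 - α := by linarith
      positivity
    rw [hm, hp]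
    nlinarith
  have hm1' : 1 ≤ m := by
    have : 0 < α ^ 3 * S := by positivity
    linarith
  have hm0 : 0 < m := by linarith
  have hN0 : 0 < N := by
    rcases hl0.eq_or_lt with h | h
    · rw [hN, ← h]; simp; positivity
    · have : l * s ≤ m * s := by gcongr; linarith
      have : 0 < l * m := by positivity
      rw [hN]; linarith
  -- The correctly decoded sections come first: their quadratic coefficient `κ` is nonpositive, so
  -- `B = 0` is allowed and the Gaussian replacement is free.
  have hx1 : ∀ x₃ w : ℝ, ∫⁻ a, eexp (l * quadDiff S α (θ * ∑ j ∈ J₁, a j) x₃ w) ∂signs ι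
      ≤ eexp (-(1 / 2) * Real.log (m / p) + 1 / 2 * l * ((w + α * x₃) ^ 2 / m - (w + x₃) ^ 2 / s)) := by
    intro x₃ w
    have hκ : 1 + -(l * α ^ 2 / p) * (J₁.card * θ ^ 2) = m / p := by
      rw [hJ₁, hm]; field_simp; ring
    have h := lintegral_signs_quadratic_le J₁ (θ := θ) le_rfl (-(l * α ^ 2 / p))
      (l * α * (w + α * x₃) / p) (by rw [hκ]; positivity)
      (by have : 0 ≤ l * α ^ 2 / p * θ ^ 2 := by positivity
          linarith)
    rw [hκ, hJ₁] at h
    have e1 : ∀ a : ι → ℝ, eexp (l * quadDiff S α (θ * ∑ j ∈ J₁, a j) x₃ w) =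
        eexp (1 / 2 * l * ((w + α * x₃) ^ 2 / p - (w + x₃) ^ 2 / s))
        * eexp (-(1 / 2) * -(l * α ^ 2 / p) * (θ * ∑ j ∈ J₁, a j) ^ 2
          + l * α * (w + α * x₃) / p * (θ * ∑ j ∈ J₁, a j)) := by
      intro a
      rw [← eexp_add]
      unfold quadDiff
      rw [← hp, ← hs]
      congr 1
      field_simp
      ring
    simp_rw [e1]
    rw [lintegral_const_mul _ (by fun_prop)]
    refine (mul_le_mul_right h _).trans ?_
    rw [← eexp_add]
    refine eexp_mono (le_of_eq ?_)
    have e2 : 1 / 2 * l * ((w + α * x₃) ^ 2 / p)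
        + 1 / 2 * (l * α * (w + α * x₃) / p) ^ 2 * ((1 - α) * S) / (m / p)
        = 1 / 2 * l * ((w + α * x₃) ^ 2 / m) := by
      have : m + l * α ^ 2 * ((1 - α) * S) = p := by rw [hm]; ring
      generalize (1 - α) * S = v at this
      field_simp
      linear_combination l * (w + α * x₃) ^ 2 * this
    linarith
  have hw : ∀ x₃ : ℝ, ∫⁻ w, eexp (-(1 / 2) * Real.log (m / p)
        + 1 / 2 * l * ((w / σ + α * x₃) ^ 2 / m - (w / σ + x₃) ^ 2 / s))
        ∂gaussianReal 0 (Real.toNNReal (σ ^ 2))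
      = eexp (-(1 / 2) * Real.log (m / p) - 1 / 2 * Real.log (N / (m * s)))
        * eexp (-(1 / 2) * (l / s - l * α ^ 2 / m - l ^ 2 * (α * s - m) ^ 2 / (m * s * N)) * x₃ ^ 2
          + 0 * x₃) := by
    intro x₃
    have hκ : 1 + (l / s - l / m) = N / (m * s) := by rw [hN]; field_simp; ring
    have hκ' : -1 < l / s - l / m := by
      have : 0 < N / (m * s) := by positivity
      linarith
    have h := lintegral_gaussian_quadratic (κ := l / s - l / m) (l * x₃ * (α / m - 1 / s)) hσ hκ'
    rw [hκ] at h
    have e1 : ∀ w : ℝ, eexp (-(1 / 2) * Real.log (m / p)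
        + 1 / 2 * l * ((w / σ + α * x₃) ^ 2 / m - (w / σ + x₃) ^ 2 / s))
        = eexp (-(1 / 2) * Real.log (m / p) + 1 / 2 * l * (α ^ 2 / m - 1 / s) * x₃ ^ 2)
        * eexp (-(1 / 2) * (l / s - l / m) * (w / σ) ^ 2
          + l * x₃ * (α / m - 1 / s) * (w / σ)) := by
      intro w
      rw [← eexp_add]
      congr 1
      generalize w / σ = v
      field_simp
      ring
    simp_rw [e1]
    rw [lintegral_const_mul _ (by fun_prop), h, ← eexp_add, ← eexp_add]
    congr 1
    have e2 : 1 / 2 * l * (α ^ 2 / m - 1 / s) * x₃ ^ 2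
        + 1 / 2 * (l * x₃ * (α / m - 1 / s)) ^ 2 / (N / (m * s))
        = -(1 / 2) * (l / s - l * α ^ 2 / m - l ^ 2 * (α * s - m) ^ 2 / (m * s * N)) * x₃ ^ 2 := by
      clear_value N m s p
      field_simp
      ring
    linarith
  refine (lintegral_mono fun a => lintegral_mono fun w => hx1 _ _).trans ?_
  simp_rw [hw]
  rw [lintegral_const_mul _ (by fun_prop)]
  set κ := l / s - l * α ^ 2 / m - l ^ 2 * (α * s - m) ^ 2 / (m * s * N) with hκ
  -- The three normalizing factors multiply to the determinant for `exp (l (U² - V²)/2)` with `U`,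
  -- `V` standard Gaussian of correlation `ρ`, namely `1 - l² (1 - ρ²)`.
  have hprod : m / p * (N / (m * s)) * (1 + κ * (α * S)) = 1 - l ^ 2 * decorrelation S α := by
    unfold decorrelation
    rw [hκ, ← hs]
    have : N * (1 + (l / s - l * α ^ 2 / m - l ^ 2 * (α * s - m) ^ 2 / (m * s * N)) * (α * S))
        = p * (s - l ^ 2 * (α * (1 - α) * S)) := by
      have : N * (1 + (l / s - l * α ^ 2 / m - l ^ 2 * (α * s - m) ^ 2 / (m * s * N)) * (α * S))
        = N + (l * N / s - l * α ^ 2 * N / m - l ^ 2 * (α * s - m) ^ 2 / (m * s)) * (α * S) := by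
        clear_value N m s p
        field_simp
      rw [this]
      have h2 : l * N / s - l * α ^ 2 * N / m - l ^ 2 * (α * s - m) ^ 2 / (m * s)
          = l * m - l * α ^ 2 * s + l ^ 2 * (-α ^ 2 + 2 * α - 1) := by
        rw [hN]
        clear_value N m s p
        field_simp
        ring
      rw [h2, hN, hm, hp, hs]
      ring
    have h3 : m / p * (N / (m * s)) * (1 + (l / s - l * α ^ 2 / m
        - l ^ 2 * (α * s - m) ^ 2 / (m * s * N)) * (α * S))
        = N * (1 + (l / s - l * α ^ 2 / m - l ^ 2 * (α * s - m) ^ 2 / (m * s * N)) * (α * S))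
          / (p * s) := by
      generalize (l / s - l * α ^ 2 / m - l ^ 2 * (α * s - m) ^ 2 / (m * s * N)) = k
      clear_value N m s p
      field_simp
    rw [h3, this]
    clear_value N m s p
    field_simp
  have hfac : 0 < m / p * (N / (m * s)) := by positivity
  have hκpos : 0 < 1 + κ * (α * S) := by
    have : 0 < m / p * (N / (m * s)) * (1 + κ * (α * S)) := by rw [hprod]; linarith
    exact (pos_iff_pos_of_mul_pos this).1 hfac
  have hκB : κ * θ ^ 2 ≤ θ ^ 2 := by
    have h2 : κ ≤ 1 := by
      have h3 : l / s ≤ 1 := by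
        rw [div_le_one hs0, hs]
        have : 0 < α * S := by positivity
        linarith
      have h4 : 0 ≤ l * α ^ 2 / m := by positivity
      have h5 : 0 ≤ l ^ 2 * (α * s - m) ^ 2 / (m * s * N) := by positivity
      linarith
    nlinarith [sq_nonneg θ]
  have h := lintegral_signs_quadratic_le J₃ (θ := θ) (sq_nonneg θ) κ 0 (by rw [hJ₃]; exact hκpos)
    hκB
  refine (mul_le_mul_right h _).trans ?_
  rw [← eexp_add]
  refine eexp_mono (le_of_eq ?_)
  rw [← hprod, hJ₃, Real.log_mul hfac.ne' hκpos.ne',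
    Real.log_mul (by positivity) (by positivity)]
  have e2 : 3 / 4 * (J₃.card : ℝ) * (θ ^ 2) ^ 2 = 3 / 4 * (α * S) * θ ^ 2 := by rw [← hJ₃]; ring
  rw [e2]
  simp
  ring

end Rows

section Rows

variable {ι : Type*} [Fintype ι] [DecidableEq ι] {S α θ σ l : ℝ}

/-- Integrating out the wrong alternative `J₂` in the tilted likelihood ratio. -/
lemma lintegral_alternative_quadDiff_le (hS : 0 < S) (hα : 0 < α)
    {J₁ J₂ J₃ : Finset ι} (h₁ : Disjoint J₁ J₂) (h₃ : Disjoint J₃ J₂)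
    (hJ₂ : J₂.card * θ ^ 2 = α * S) :
    ∫⁻ a, ∫⁻ w, eexp ((l - 1) * quadDiff S α (θ * ∑ j ∈ J₁, a j) (θ * ∑ j ∈ J₃, a j) (w / σ)
        + 1 / 2 * ((w / σ + α * (θ * ∑ j ∈ J₁, a j + θ * ∑ j ∈ J₃, a j)) ^ 2 / (1 + α ^ 2 * S)
          - (w / σ + θ * ∑ j ∈ J₃, a j - θ * ∑ j ∈ J₂, a j) ^ 2))
        ∂gaussianReal 0 (Real.toNNReal (σ ^ 2)) ∂signs ι
      ≤ eexp (3 / 4 * (α * S) * θ ^ 2 - capacityFrac S α)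
        * ∫⁻ a, ∫⁻ w, eexp (l * quadDiff S α (θ * ∑ j ∈ J₁, a j) (θ * ∑ j ∈ J₃, a j) (w / σ))
          ∂gaussianReal 0 (Real.toNNReal (σ ^ 2)) ∂signs ι := by
  have hF : Measurable (Function.uncurry fun (z : ℝ × ℝ) (x₂ : ℝ) => ∫⁻ w,
      eexp ((l - 1) * quadDiff S α (θ * z.1) (θ * z.2) (w / σ)
        + 1 / 2 * ((w / σ + α * (θ * z.1 + θ * z.2)) ^ 2 / (1 + α ^ 2 * S)
          - (w / σ + θ * z.2 - θ * x₂) ^ 2)) ∂gaussianReal 0 (Real.toNNReal (σ ^ 2))) := by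
    refine Measurable.lintegral_prod_right' (f := fun y : ((ℝ × ℝ) × ℝ) × ℝ =>
      eexp ((l - 1) * quadDiff S α (θ * y.1.1.1) (θ * y.1.1.2) (y.2 / σ)
        + 1 / 2 * ((y.2 / σ + α * (θ * y.1.1.1 + θ * y.1.1.2)) ^ 2 / (1 + α ^ 2 * S)
          - (y.2 / σ + θ * y.1.1.2 - θ * y.1.2) ^ 2))) ?_
    unfold quadDiff
    fun_prop
  have h1 := lintegral_indepFun (μ := signs ι) (by fun_prop) (by fun_prop)
    (indepFun_sum_pair h₁ h₃) hF
  dsimp only at h1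
  rw [h1, ← lintegral_const_mul]
  swap
  · refine Measurable.lintegral_prod_right' (f := fun y : (ι → ℝ) × ℝ =>
      eexp (l * quadDiff S α (θ * ∑ j ∈ J₁, y.1 j) (θ * ∑ j ∈ J₃, y.1 j) (y.2 / σ))) ?_
    unfold quadDiff
    fun_prop
  refine lintegral_mono fun a => ?_
  dsimp only
  generalize ∑ j ∈ J₁, a j = s₁
  generalize ∑ j ∈ J₃, a j = s₃
  rw [lintegral_lintegral_swap]
  swap
  · unfold quadDiff Function.uncurry
    fun_prop
  rw [← lintegral_const_mul]
  swap
  · unfold quadDiff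
    fun_prop
  refine lintegral_mono fun w => ?_
  dsimp only
  have e1 : ∀ b : ι → ℝ, eexp ((l - 1) * quadDiff S α (θ * s₁) (θ * s₃) (w / σ)
        + 1 / 2 * ((w / σ + α * (θ * s₁ + θ * s₃)) ^ 2 / (1 + α ^ 2 * S)
          - (w / σ + θ * s₃ - θ * ∑ j ∈ J₂, b j) ^ 2))
      = eexp ((l - 1) * quadDiff S α (θ * s₁) (θ * s₃) (w / σ)
        + 1 / 2 * (w / σ + α * (θ * s₁ + θ * s₃)) ^ 2 / (1 + α ^ 2 * S))
        * eexp (-(1 / 2) * ((w / σ + θ * s₃) - θ * ∑ j ∈ J₂, b j) ^ 2) := by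
    intro b
    rw [← eexp_add]
    congr 1
    ring
  simp_rw [e1]
  rw [lintegral_const_mul _ (by fun_prop)]
  -- Averaging over `J₂` replaces the square by `(w/σ + θ s₃)²/(1 + αS)`. The added term then is
  -- `quadDiff` itself and raises the tilt from `l - 1` to `l`.
  refine (mul_le_mul_right (lintegral_alternative_le hS hα hJ₂ _) _).trans ?_
  rw [← eexp_add, ← eexp_add]
  refine eexp_mono (le_of_eq ?_)
  unfold quadDiff
  ring

/-- The exponential moment of the message-independent part of the test statistic. -/
lemma lintegral_noise_le (hS : 0 < S) (hα : 0 < α) (hσ : 0 < σ) (hl0 : 0 ≤ l)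
    (hl1 : l ^ 2 * (α ^ 2 * S / (1 + α ^ 2 * S)) < 1) {J : Finset ι} (hJ0 : 0 < J.card)
    (hJ : J.card * θ ^ 2 = S) :
    ∫⁻ a, ∫⁻ w, eexp (l * (1 / 2 * ((w / σ) ^ 2
        - (w / σ + α * (θ * ∑ j ∈ J, a j)) ^ 2 / (1 + α ^ 2 * S))))
        ∂gaussianReal 0 (Real.toNNReal (σ ^ 2)) ∂signs ι
      ≤ eexp (3 / 4 / J.card - 1 / 2 * Real.log (1 - l ^ 2 * (α ^ 2 * S / (1 + α ^ 2 * S)))) := by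
  set p := 1 + α ^ 2 * S with hp
  have hp0 : 0 < p := by positivity
  set u := α ^ 2 * S / p with hu
  have hu0 : 0 < u := by positivity
  have hu1 : u < 1 := by rw [hu, div_lt_one hp0]; linarith
  have hlu : l * u < 1 := by
    have h : (l * u) ^ 2 < 1 := by nlinarith
    have : 0 ≤ l * u := by positivity
    nlinarith
  have hlu' : 0 < 1 - l * u := by linarith
  set κ := l * α ^ 2 / p - l ^ 2 * α ^ 2 / (p ^ 2 * (1 - l * u)) with hκ
  have hw : ∀ x : ℝ, ∫⁻ w, eexp (l * (1 / 2 * ((w / σ) ^ 2 - (w / σ + α * x) ^ 2 / p)))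
        ∂gaussianReal 0 (Real.toNNReal (σ ^ 2))
      = eexp (-(1 / 2) * Real.log (1 - l * u)) * eexp (-(1 / 2) * κ * x ^ 2 + 0 * x) := by
    intro x
    have h := lintegral_gaussian_quadratic (κ := -(l * u)) (-(l * α * x / p)) hσ (by linarith)
    rw [← sub_eq_add_neg] at h
    have e1 : ∀ w : ℝ, eexp (l * (1 / 2 * ((w / σ) ^ 2 - (w / σ + α * x) ^ 2 / p)))
        = eexp (-(1 / 2) * (l * α ^ 2 / p) * x ^ 2)
        * eexp (-(1 / 2) * -(l * u) * (w / σ) ^ 2 + -(l * α * x / p) * (w / σ)) := by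
      intro w
      rw [← eexp_add]
      congr 1
      generalize w / σ = v
      have : u = 1 - 1 / p := by rw [hu, hp]; field_simp; ring
      rw [this]
      field_simp
      ring
    simp_rw [e1]
    rw [lintegral_const_mul _ (by fun_prop), h, ← eexp_add, ← eexp_add]
    congr 1
    have e2 : 1 / 2 * (-(l * α * x / p)) ^ 2 / (1 - l * u)
        = 1 / 2 * (l ^ 2 * α ^ 2 / (p ^ 2 * (1 - l * u))) * x ^ 2 := by
      generalize 1 - l * u = d at hlu'
      field_simp
    rw [e2, hκ]
    ring
  simp_rw [hw]
  rw [lintegral_const_mul _ (by fun_prop)]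
  have hprod : (1 - l * u) * (1 + κ * S) = 1 - l ^ 2 * u := by
    have h1 : (1 - l * u) * κ = (1 - l * u) * (l * α ^ 2 / p) - l ^ 2 * α ^ 2 / p ^ 2 := by
      rw [hκ]
      generalize 1 - l * u = d at hlu'
      field_simp
    have h2 : (1 - l * u) * (1 + κ * S) = (1 - l * u) + ((1 - l * u) * κ) * S := by ring
    have h3 : α ^ 2 * S = u * p := by rw [hu]; field_simp
    have h4 : u * p = p - 1 := by rw [← h3, hp]; ring
    have h5 : ((1 - l * u) * (l * α ^ 2 / p) - l ^ 2 * α ^ 2 / p ^ 2) * S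
        = (1 - l * u) * (l * u) - l ^ 2 * u / p := by
      have : ((1 - l * u) * (l * α ^ 2 / p) - l ^ 2 * α ^ 2 / p ^ 2) * S
        = (1 - l * u) * (l * (α ^ 2 * S) / p) - l ^ 2 * (α ^ 2 * S) / p ^ 2 := by ring
      rw [this, h3]
      clear_value u p
      field_simp
    have h6 : 1 / p = 1 - u := by
      rw [div_eq_iff hp0.ne']; linarith
    rw [h2, h1, h5, div_eq_mul_one_div (l ^ 2 * u), h6]
    ring
  have hκpos : 0 < 1 + κ * S := by
    have : 0 < (1 - l * u) * (1 + κ * S) := by rw [hprod]; linarith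
    exact (pos_iff_pos_of_mul_pos this).1 hlu'
  have hJr : (0 : ℝ) < J.card := by exact_mod_cast hJ0
  -- Here `l` may exceed `1`, and only `l u < 1` is available. This still gives `κ ≤ 1/S`, which
  -- suffices since `θ² = S / J.card`.
  have hκB : κ * θ ^ 2 ≤ 1 / J.card := by
    have h1 : κ ≤ 1 / S := by
      have h2 : 0 ≤ l ^ 2 * α ^ 2 / (p ^ 2 * (1 - l * u)) := by positivity
      have h3 : l * α ^ 2 / p = l * u / S := by rw [hu]; field_simp
      have h4 : l * u / S ≤ 1 / S := by gcongr
      linarith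
    have h5 : θ ^ 2 = S / J.card := by rw [← hJ]; field_simp
    calc κ * θ ^ 2 ≤ 1 / S * θ ^ 2 := by gcongr
      _ = 1 / (J.card : ℝ) := by rw [h5, one_div_mul_eq_div, div_right_comm, div_self hS.ne']
  have h := lintegral_signs_quadratic_le J (θ := θ) (B := 1 / J.card) (by positivity) κ 0
    (by rw [hJ]; exact hκpos) hκB
  refine (mul_le_mul_right h _).trans ?_
  rw [← eexp_add]
  refine eexp_mono (le_of_eq ?_)
  rw [← hprod, hJ, Real.log_mul hlu'.ne' hκpos.ne']
  have : 3 / 4 * (J.card : ℝ) * (1 / J.card) ^ 2 = 3 / 4 / J.card := by field_simp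
  rw [this]
  simp
  ring

end Rows

/-! ### Error events -/

/-- Weighted AM-GM, in place of Gallager's `min(1, x) ≤ x ^ l`. In the application `E` is the
logarithm of the union bound conditional on the sent codeword and the noise, and `X ≥ 0` on the
error event. Averaging `exp X` over the alternatives restores a factor `exp E`, so both terms end up
with the bound for `exp (l E)`, with weights summing to `1`. -/
lemma one_le_of_tilt {l E X : ℝ} (hl0 : 0 ≤ l) (hl1 : l ≤ 1) (hX : 0 ≤ X) :
    1 ≤ (1 - l) * Real.exp (l * E) + l * Real.exp ((l - 1) * E + X) := by
  have h := convexOn_exp.2 (Set.mem_univ 0) (Set.mem_univ (-E)) (show 0 ≤ 1 - l by linarith) hl0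
    (by ring)
  simp only [smul_eq_mul, mul_zero, zero_add, Real.exp_zero, mul_one] at h
  have h1 : Real.exp ((l - 1) * E) ≤ Real.exp ((l - 1) * E + X) := Real.exp_le_exp.2 (by linarith)
  have h2 : Real.exp ((l - 1) * E) = Real.exp (l * E) * Real.exp (-E) := by
    rw [← Real.exp_add]; congr 1; ring
  have h3 : Real.exp (l * E) * Real.exp (l * -E) = 1 := by
    rw [← Real.exp_add, show l * E + l * -E = 0 by ring, Real.exp_zero]
  calc (1 : ℝ) = Real.exp (l * E) * Real.exp (l * -E) := h3.symm
    _ ≤ Real.exp (l * E) * (1 - l + l * Real.exp (-E)) := by gcongr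
    _ = (1 - l) * Real.exp (l * E) + l * Real.exp ((l - 1) * E) := by rw [h2]; ring
    _ ≤ _ := by gcongr

/-- The positions of the nonzero entries of a message, as a function of the section. -/
def position {L M : ℕ} (s : Fin L → Fin M) : Fin L ↪ Fin L × Fin M :=
  ⟨fun j => (j, s j), fun _ _ h => (Prod.ext_iff.1 h).1⟩

/-- The sections in which two messages differ. -/
def diffSections {L M : ℕ} (s s' : Fin L → Fin M) : Finset (Fin L) :=
  Finset.univ.filter fun j => s' j ≠ s j

lemma card_diffSections_eq_le {L M : ℕ} (s : Fin L → Fin M) (T : Finset (Fin L)) :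
    (Finset.univ.filter fun s' : Fin L → Fin M => diffSections s s' = T).card ≤ M ^ T.card := by
  have h : (Finset.univ.filter fun s' : Fin L → Fin M => diffSections s s' = T).card
      ≤ (Finset.univ : Finset (T → Fin M)).card := by
    refine Finset.card_le_card_of_injOn (fun s' j => s' j) (fun _ _ => Finset.mem_univ _) ?_
    intro s₁ h₁ s₂ h₂ h
    simp only [Finset.coe_filter, Finset.mem_univ, true_and, Set.mem_ofPred_eq] at h₁ h₂
    funext j
    by_cases hj : j ∈ T
    · exact congrFun h ⟨j, hj⟩
    · have e₁ : s₁ j = s j := by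
        by_contra hne
        exact hj (h₁ ▸ by simp [diffSections, hne])
      have e₂ : s₂ j = s j := by
        by_contra hne
        exact hj (h₂ ▸ by simp [diffSections, hne])
      rw [e₁, e₂]
  simpa using h

/-! ### Chernoff bounds for a whole block -/

section Block

variable {n L M : ℕ} {S θ σ : ℝ}

/-- The joint law of the dictionary and the noise. -/
def channelLaw (n L M : ℕ) (σ : ℝ) :
    Measure ((Fin n → Fin L × Fin M → ℝ) × (Fin n → ℝ)) :=
  (bernoulliDictionary n L M).prod (awgnNoise n σ)

lemma lintegral_channelLaw_exp_sum {F : (Fin L × Fin M → ℝ) → ℝ → ℝ}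
    (hF : Measurable (Function.uncurry F)) (c : ℝ) :
    ∫⁻ q, eexp (c + ∑ i, F (q.1 i) (q.2 i)) ∂channelLaw n L M σ
      = eexp c * (∫⁻ a, ∫⁻ w, eexp (F a w) ∂gaussianReal 0 (Real.toNNReal (σ ^ 2))
          ∂signs (Fin L × Fin M)) ^ n := by
  have hF' : Measurable (Function.uncurry fun a w => eexp (F a w)) := measurable_eexp.comp hF
  rw [← lintegral_prod_pi_fin_pow n hF', ← lintegral_const_mul]
  · simp_rw [eexp_add, eexp_sum]
    rfl
  · refine Finset.measurable_fun_prod _ fun i _ => ?_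
    have hp : Measurable fun q : (Fin n → Fin L × Fin M → ℝ) × (Fin n → ℝ) => (q.1 i, q.2 i) := by
      fun_prop
    exact hF'.comp hp

lemma measurable_exp_sum {F : (Fin L × Fin M → ℝ) → ℝ → ℝ}
    (hF : Measurable (Function.uncurry F)) (c : ℝ) :
    Measurable fun q : (Fin n → Fin L × Fin M → ℝ) × (Fin n → ℝ) =>
      eexp (c + ∑ i, F (q.1 i) (q.2 i)) := by
  refine measurable_eexp.comp (measurable_const.add (Finset.measurable_fun_sum _ fun i _ => ?_))
  have hp : Measurable fun q : (Fin n → Fin L × Fin M → ℝ) × (Fin n → ℝ) => (q.1 i, q.2 i) := by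
    fun_prop
  exact hF.comp hp

lemma measure_le_of_one_le {Ω : Type*} [MeasurableSpace Ω] {μ : Measure Ω} {f : Ω → ℝ≥0∞}
    (hf : Measurable f) {s : Set Ω} (hs : ∀ ω ∈ s, 1 ≤ f ω) : μ s ≤ ∫⁻ ω, f ω ∂μ := by
  have h := mul_meas_ge_le_lintegral (μ := μ) hf 1
  rw [one_mul] at h
  exact (measure_mono hs).trans h

/-- The codeword entry of the message `s` in a row `a` of the dictionary. -/
def rowSum (θ : ℝ) (s : Fin L → Fin M) (a : Fin L × Fin M → ℝ) : ℝ := θ * ∑ j, a (j, s j)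

lemma rowSum_eq (s : Fin L → Fin M) (a : Fin L × Fin M → ℝ) :
    rowSum θ s a = θ * ∑ j ∈ Finset.univ.map (position s), a j := by
  unfold rowSum
  rw [Finset.sum_map]
  rfl

lemma rowSum_split (s : Fin L → Fin M) (T : Finset (Fin L)) (a : Fin L × Fin M → ℝ) :
    rowSum θ s a = θ * ∑ j ∈ Tᶜ.map (position s), a j + θ * ∑ j ∈ T.map (position s), a j := by
  unfold rowSum
  rw [Finset.sum_map, Finset.sum_map, ← mul_add, Finset.sum_compl_add_sum]
  rfl

lemma rowSum_split_diff {s s' : Fin L → Fin M} {T : Finset (Fin L)} (h : diffSections s s' = T)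
    (a : Fin L × Fin M → ℝ) :
    rowSum θ s' a = θ * ∑ j ∈ Tᶜ.map (position s), a j + θ * ∑ j ∈ T.map (position s'), a j := by
  rw [rowSum_split s' T, Finset.sum_map, Finset.sum_map, Finset.sum_map]
  congr 2
  refine Finset.sum_congr rfl fun j hj => ?_
  have : s' j = s j := by
    by_contra hne
    rw [Finset.mem_compl, ← h] at hj
    exact hj (by simp [diffSections, hne])
  change a (j, s' j) = a (j, s j)
  rw [this]

lemma disjoint_position {s s' : Fin L → Fin M} {T U : Finset (Fin L)}
    (h : ∀ j ∈ T, j ∈ U → s j ≠ s' j) : Disjoint (T.map (position s)) (U.map (position s')) := by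
  rw [Finset.disjoint_left]
  intro x hx hx'
  obtain ⟨j, hj, rfl⟩ := Finset.mem_map.1 hx
  obtain ⟨k, hk, hjk⟩ := Finset.mem_map.1 hx'
  have h1 : k = j := congrArg Prod.fst hjk
  subst h1
  exact h k hj hk (congrArg Prod.snd hjk).symm

/-- The probability that some message differing from `s` exactly in the sections `T` has a small
test statistic. -/
lemma measure_exists_alternative_le (hS : 0 < S) (hσ : 0 < σ) (hθ : L * θ ^ 2 = S)
    (s : Fin L → Fin M) (T : Finset (Fin L)) (hT : T.Nonempty) {l t : ℝ} (hl0 : 0 ≤ l)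
    (hl1 : l ≤ 1) {α : ℝ} (hα : α = (T.card : ℝ) / L) :
    channelLaw n L M σ {q | ∃ s', diffSections s s' = T ∧
      ∑ i, 1 / 2 * ((q.2 i / σ + rowSum θ s (q.1 i) - rowSum θ s' (q.1 i)) ^ 2
        - (q.2 i / σ + α * rowSum θ s (q.1 i)) ^ 2 / (1 + α ^ 2 * S)) ≤ n * t}
      ≤ eexp (n * (3 / 2 * S * θ ^ 2)
          - (n * tiltExponent l (capacityFrac S α - t) (decorrelation S α)
            - l * (T.card * Real.log M))) := by
  have hL : 0 < L := by
    obtain ⟨j, _⟩ := hT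
    exact j.pos
  have hM : 0 < M := by
    obtain ⟨j, _⟩ := hT
    exact (s j).pos
  have hLr : (0 : ℝ) < L := by exact_mod_cast hL
  have hMr : (0 : ℝ) < M := by exact_mod_cast hM
  have hTr : (0 : ℝ) < T.card := by exact_mod_cast hT.card_pos
  have hα0 : 0 < α := by rw [hα]; positivity
  have hα1 : α ≤ 1 := by
    rw [hα, div_le_one hLr]
    exact_mod_cast (Finset.card_le_univ T).trans (by simp)
  have hJT : (T.card : ℝ) * θ ^ 2 = α * S := by rw [hα, ← hθ]; field_simp
  have hJc : ((Tᶜ).card : ℝ) * θ ^ 2 = (1 - α) * S := by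
    have : (Tᶜ.card : ℝ) = L - T.card := by
      rw [Finset.card_compl, Fintype.card_fin, Nat.cast_sub]
      exact (Finset.card_le_univ T).trans (by simp)
    rw [this, sub_mul, hθ, hJT]; ring
  set J₁ := Tᶜ.map (position s) with hJ₁
  set J₃ := T.map (position s) with hJ₃
  set D := 3 / 4 * (α * S) * θ ^ 2 with hD
  set G := D - 1 / 2 * Real.log (1 - l ^ 2 * decorrelation S α) with hG
  -- The terms account for the number of competitors, the threshold, and the factor per row from
  -- averaging out the alternative; `A + ∑ Q` is the logarithm of the conditional union bound.
  set A : ℝ := T.card * Real.log M + n * t + n * (D - capacityFrac S α) with hA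
  set Q : (Fin L × Fin M → ℝ) → ℝ → ℝ := fun a w =>
    quadDiff S α (θ * ∑ j ∈ J₁, a j) (θ * ∑ j ∈ J₃, a j) (w / σ) with hQ
  set W : (Fin L → Fin M) → (Fin L × Fin M → ℝ) → ℝ → ℝ := fun s' a w =>
    1 / 2 * ((w / σ + α * (θ * ∑ j ∈ J₁, a j + θ * ∑ j ∈ J₃, a j)) ^ 2 / (1 + α ^ 2 * S)
      - (w / σ + θ * ∑ j ∈ J₃, a j - θ * ∑ j ∈ T.map (position s'), a j) ^ 2) with hW
  have hQm : Measurable (Function.uncurry fun a w => l * Q a w) := by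
    unfold Function.uncurry
    simp only [hQ, quadDiff]
    fun_prop
  have hWm : ∀ s', Measurable (Function.uncurry fun a w => (l - 1) * Q a w + W s' a w) := by
    intro s'
    unfold Function.uncurry
    simp only [hQ, hW, quadDiff]
    fun_prop
  set F := Finset.univ.filter fun s' : Fin L → Fin M => diffSections s s' = T with hF
  set f : (Fin n → Fin L × Fin M → ℝ) × (Fin n → ℝ) → ℝ≥0∞ := fun q =>
    ENNReal.ofReal (1 - l) * eexp (l * A + ∑ i, l * Q (q.1 i) (q.2 i))
    + ∑ s' ∈ F, ENNReal.ofReal l * eexp (((l - 1) * A + n * t)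
      + ∑ i, ((l - 1) * Q (q.1 i) (q.2 i) + W s' (q.1 i) (q.2 i))) with hf
  have hfm : Measurable f := by
    refine ((measurable_exp_sum hQm _).const_mul _).add ?_
    exact Finset.measurable_fun_sum _ fun s' _ => (measurable_exp_sum (hWm s') _).const_mul _
  refine (measure_le_of_one_le hfm ?_).trans ?_
  · rintro q ⟨s', hs', hq⟩
    set E := A + ∑ i, Q (q.1 i) (q.2 i)
    set X := n * t + ∑ i, W s' (q.1 i) (q.2 i) with hX
    have hX0 : 0 ≤ X := by
      have : ∑ i, 1 / 2 * ((q.2 i / σ + rowSum θ s (q.1 i) - rowSum θ s' (q.1 i)) ^ 2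
        - (q.2 i / σ + α * rowSum θ s (q.1 i)) ^ 2 / (1 + α ^ 2 * S))
        = -∑ i, W s' (q.1 i) (q.2 i) := by
        rw [← Finset.sum_neg_distrib]
        refine Finset.sum_congr rfl fun i _ => ?_
        simp only [hW]
        rw [rowSum_split_diff hs', rowSum_split s T]
        ring
      rw [this] at hq
      linarith
    have h1 := one_le_of_tilt (E := E) hl0 hl1 hX0
    have hsF : s' ∈ F := by simp [hF, hs']
    calc (1 : ℝ≥0∞) ≤ ENNReal.ofReal ((1 - l) * Real.exp (l * E)
          + l * Real.exp ((l - 1) * E + X)) := by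
          rw [← ENNReal.ofReal_one]; exact ENNReal.ofReal_le_ofReal h1
      _ = ENNReal.ofReal (1 - l) * eexp (l * A + ∑ i, l * Q (q.1 i) (q.2 i))
          + ENNReal.ofReal l * eexp (((l - 1) * A + n * t)
          + ∑ i, ((l - 1) * Q (q.1 i) (q.2 i) + W s' (q.1 i) (q.2 i))) := by
          have h1l : 0 ≤ 1 - l := by linarith
          rw [ENNReal.ofReal_add (by positivity) (by positivity), ENNReal.ofReal_mul h1l,
            ENNReal.ofReal_mul hl0]
          unfold eexp
          rw [← Finset.mul_sum, Finset.sum_add_distrib, ← Finset.mul_sum]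
          congr 4
          · ring
          · rw [hX]; ring
      _ ≤ f q := by
          rw [hf]
          refine add_le_add le_rfl ?_
          exact Finset.single_le_sum (f := fun s' => ENNReal.ofReal l * eexp (((l - 1) * A + n * t)
            + ∑ i, ((l - 1) * Q (q.1 i) (q.2 i) + W s' (q.1 i) (q.2 i))))
            (fun _ _ => zero_le) hsF
  · rw [hf, lintegral_add_left ((measurable_exp_sum hQm _).const_mul _),
      lintegral_const_mul _ (measurable_exp_sum hQm _),
      lintegral_finsetSum _ fun s' _ => (measurable_exp_sum (hWm s') _).const_mul _]
    simp_rw [lintegral_const_mul _ (measurable_exp_sum (hWm _) _)]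
    rw [lintegral_channelLaw_exp_sum hQm]
    simp_rw [lintegral_channelLaw_exp_sum (hWm _)]
    set I := ∫⁻ a, ∫⁻ w, eexp (l * Q a w) ∂gaussianReal 0 (Real.toNNReal (σ ^ 2))
      ∂signs (Fin L × Fin M) with hI
    have hIG : I ≤ eexp G := lintegral_quadDiff_le hS hα0 hα1 hσ hl0 hl1
      (disjoint_position fun j h1 h2 => absurd h2 (Finset.mem_compl.1 h1))
      (by rw [Finset.card_map]; exact hJc) (by rw [Finset.card_map]; exact hJT)
    have hrow : ∀ s' ∈ F, ∫⁻ a, ∫⁻ w, eexp ((l - 1) * Q a w + W s' a w)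
        ∂gaussianReal 0 (Real.toNNReal (σ ^ 2)) ∂signs (Fin L × Fin M)
        ≤ eexp (D - capacityFrac S α) * I := by
      intro s' hs'
      have hs'' : diffSections s s' = T := by simpa [hF] using hs'
      refine lintegral_alternative_quadDiff_le hS hα0 ?_ ?_ (by rw [Finset.card_map]; exact hJT)
      · exact disjoint_position fun j h1 h2 => absurd h2 (Finset.mem_compl.1 h1)
      · refine disjoint_position fun j h1 _ => ?_
        rw [← hs''] at h1
        exact fun h => (Finset.mem_filter.1 h1).2 h.symm
    have hcardM : ((M : ℝ≥0∞)) ^ T.card = eexp (T.card * Real.log M) := by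
      unfold eexp
      rw [Real.exp_nat_mul, Real.exp_log hMr, ENNReal.ofReal_pow hMr.le, ENNReal.ofReal_natCast]
    have hsum : ∑ s' ∈ F, ENNReal.ofReal l * (eexp ((l - 1) * A + n * t) *
        (∫⁻ a, ∫⁻ w, eexp ((l - 1) * Q a w + W s' a w)
        ∂gaussianReal 0 (Real.toNNReal (σ ^ 2)) ∂signs (Fin L × Fin M)) ^ n)
        ≤ ENNReal.ofReal l * (eexp (l * A) * I ^ n) := by
      calc _ ≤ ∑ s' ∈ F, ENNReal.ofReal l * (eexp ((l - 1) * A + n * t) *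
            (eexp (D - capacityFrac S α) * I) ^ n) := by
            refine Finset.sum_le_sum fun s' hs' => ?_
            gcongr
            exact hrow s' hs'
        _ = F.card * (ENNReal.ofReal l * (eexp ((l - 1) * A + n * t) *
            (eexp (D - capacityFrac S α) * I) ^ n)) := by
            rw [Finset.sum_const, nsmul_eq_mul]
        _ ≤ (M : ℝ≥0∞) ^ T.card * (ENNReal.ofReal l * (eexp ((l - 1) * A + n * t) *
            (eexp (D - capacityFrac S α) * I) ^ n)) := by
            gcongr
            exact_mod_cast card_diffSections_eq_le s T
        _ = ENNReal.ofReal l * ((eexp (T.card * Real.log M) * eexp ((l - 1) * A + n * t) *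
            eexp (n * (D - capacityFrac S α))) * I ^ n) := by
            rw [hcardM, mul_pow, eexp_pow]
            ring
        _ = ENNReal.ofReal l * (eexp (l * A) * I ^ n) := by
            rw [← eexp_add, ← eexp_add]
            congr 3
            rw [hA]; ring
    refine (add_le_add le_rfl hsum).trans ?_
    rw [← add_mul, ← ENNReal.ofReal_add (by linarith) hl0, sub_add_cancel, ENNReal.ofReal_one,
      one_mul]
    calc eexp (l * A) * I ^ n ≤ eexp (l * A) * eexp G ^ n := by gcongr
      _ = eexp (l * A + n * G) := by rw [eexp_pow, ← eexp_add]
      _ ≤ _ := by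
        refine eexp_mono ?_
        have hn0 : (0 : ℝ) ≤ n := Nat.cast_nonneg n
        have hD2 : D ≤ 3 / 4 * S * θ ^ 2 := by
          have : α * S ≤ 1 * S := by gcongr
          rw [hD]
          nlinarith [sq_nonneg θ]
        have hD0 : 0 ≤ D := by positivity
        have h1 : n * ((l + 1) * D) ≤ n * (2 * (3 / 4 * S * θ ^ 2)) := by
          gcongr
          linarith
        rw [hA, hG]
        unfold tiltExponent
        linarith

/-- The probability that the message-independent part of the test statistic is very negative. -/
lemma measure_noise_le (hS : 0 < S) (hσ : 0 < σ) (hL : 0 < L) (hθ : L * θ ^ 2 = S)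
    (s : Fin L → Fin M) {l t α : ℝ} (hα : 0 < α) (hl0 : 0 ≤ l)
    (hl1 : l ^ 2 * (α ^ 2 * S / (1 + α ^ 2 * S)) < 1) :
    channelLaw n L M σ {q | n * t ≤ ∑ i, 1 / 2 * ((q.2 i / σ) ^ 2
        - (q.2 i / σ + α * rowSum θ s (q.1 i)) ^ 2 / (1 + α ^ 2 * S))}
      ≤ eexp (n * (3 / 4 / L) - n * tiltExponent l t (α ^ 2 * S / (1 + α ^ 2 * S))) := by
  set J := Finset.univ.map (position s) with hJ
  have hJc : J.card = L := by simp [hJ]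
  set V : (Fin L × Fin M → ℝ) → ℝ → ℝ := fun a w => l * (1 / 2 * ((w / σ) ^ 2
        - (w / σ + α * (θ * ∑ j ∈ J, a j)) ^ 2 / (1 + α ^ 2 * S))) with hV
  have hVm : Measurable (Function.uncurry V) := by
    unfold Function.uncurry
    simp only [hV]
    fun_prop
  refine (measure_le_of_one_le (measurable_exp_sum hVm (-(l * (n * t)))) ?_).trans ?_
  · intro q hq
    refine one_le_eexp ?_
    have h := mul_le_mul_of_nonneg_left hq hl0
    simp only [hV]
    rw [← Finset.mul_sum]
    simp_rw [rowSum_eq] at h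
    linarith
  · rw [lintegral_channelLaw_exp_sum hVm]
    have h := lintegral_noise_le (σ := σ) hS hα hσ hl0 hl1 (J := J) (by rw [hJc]; exact hL)
      (by rw [hJc]; exact hθ)
    rw [hJc] at h
    calc _ ≤ eexp (-(l * (n * t))) * (eexp (3 / 4 / L
          - 1 / 2 * Real.log (1 - l ^ 2 * (α ^ 2 * S / (1 + α ^ 2 * S))))) ^ n := by gcongr
      _ = _ := by
        rw [eexp_pow, ← eexp_add]
        congr 1
        unfold tiltExponent
        ring

end Block

/-! ### From decoding errors to the two tail events -/

section Decoding

variable {n L M : ℕ} {S θ σ : ℝ}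

/-- The noisy codeword of `s` is at least as close to the codeword of `s'` as to that of `s`. -/
def Prefers (θ σ : ℝ) (s s' : Fin L → Fin M)
    (q : (Fin n → Fin L × Fin M → ℝ) × (Fin n → ℝ)) : Prop :=
  ∑ i, (q.2 i / σ + rowSum θ s (q.1 i) - rowSum θ s' (q.1 i)) ^ 2 ≤ ∑ i, (q.2 i / σ) ^ 2

/-- Both squared distances are compared with the reference that depends on `s'` only through `α`.
Hence the union over the sets `T` of wrong sections multiplies the first event alone, where the
binomial factor cancels the entropy term of `HasTilts`; the noise event is counted once. -/
lemma measure_prefers_le (hS : 0 < S) (hσ : 0 < σ) (hn : 0 < n) (hθ : L * θ ^ 2 = S)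
    (s : Fin L → Fin M) {l : ℕ} (hl : 1 ≤ l) (hlL : l ≤ L) {R h : ℝ}
    (hR : n * R = L * Real.log M)
    (htilt : HasTilts S ((l : ℝ) / L) (capacity S - R) (Real.log (L.choose l) / n) h) :
    channelLaw n L M σ {q | ∃ s', (diffSections s s').card = l ∧ Prefers θ σ s s' q}
      ≤ 2 * eexp (n * ((3 / 2 * S ^ 2 + 3 / 4) / L) - n * h) := by
  obtain ⟨t, l₁, l₂, hl₁, hl₂, hl₂', h1, h2⟩ := htilt
  have hL : 0 < L := by omega
  have hLr : (0 : ℝ) < L := by exact_mod_cast hL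
  have hnr : (0 : ℝ) < n := by exact_mod_cast hn
  have hlr : (0 : ℝ) < l := by exact_mod_cast hl
  set α := (l : ℝ) / L with hα
  have hα0 : 0 < α := by positivity
  set 𝒯 := Finset.powersetCard l (Finset.univ : Finset (Fin L)) with h𝒯
  set ev : Finset (Fin L) → Set ((Fin n → Fin L × Fin M → ℝ) × (Fin n → ℝ)) := fun T =>
    {q | ∃ s', diffSections s s' = T ∧
      ∑ i, 1 / 2 * ((q.2 i / σ + rowSum θ s (q.1 i) - rowSum θ s' (q.1 i)) ^ 2
        - (q.2 i / σ + α * rowSum θ s (q.1 i)) ^ 2 / (1 + α ^ 2 * S)) ≤ n * t} with hev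
  have hsub : {q | ∃ s', (diffSections s s').card = l ∧ Prefers θ σ s s' q}
      ⊆ (⋃ T ∈ 𝒯, ev T) ∪ {q | n * t ≤ ∑ i, 1 / 2 * ((q.2 i / σ) ^ 2
        - (q.2 i / σ + α * rowSum θ s (q.1 i)) ^ 2 / (1 + α ^ 2 * S))} := by
    rintro q ⟨s', hc, hp⟩
    rcases le_or_gt (∑ i, 1 / 2 * ((q.2 i / σ + rowSum θ s (q.1 i) - rowSum θ s' (q.1 i)) ^ 2
        - (q.2 i / σ + α * rowSum θ s (q.1 i)) ^ 2 / (1 + α ^ 2 * S))) (n * t) with hle | hgt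
    · refine Or.inl (Set.mem_biUnion (x := diffSections s s') ?_ ⟨s', rfl, hle⟩)
      rw [h𝒯, Finset.mem_coe, Finset.mem_powersetCard]
      exact ⟨Finset.subset_univ _, hc⟩
    · refine Or.inr (hgt.le.trans ?_)
      unfold Prefers at hp
      rw [← Finset.mul_sum, ← Finset.mul_sum, Finset.sum_sub_distrib, Finset.sum_sub_distrib]
      linarith
  have hθ2 : θ ^ 2 = S / L := by rw [← hθ]; field_simp
  have hT : ∀ T ∈ 𝒯, channelLaw n L M σ (ev T)
      ≤ eexp (n * ((3 / 2 * S ^ 2 + 3 / 4) / L) - n * h - Real.log (L.choose l)) := by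
    intro T hT
    have hcard : T.card = l := (Finset.mem_powersetCard.1 hT).2
    refine (measure_exists_alternative_le hS hσ hθ s T (Finset.card_pos.1 (by omega)) hl₁.1 hl₁.2
      (by rw [hcard, hα])).trans (eexp_mono ?_)
    rw [hcard, hθ2]
    have e1 : (l : ℝ) * Real.log M = n * (α * R) := by
      have : n * (α * R) = α * (n * R) := by ring
      rw [this, hR, hα]
      field_simp
    have e2 : capacityGap S α + α * (capacity S - R) - t = capacityFrac S α - t - α * R := by
      unfold capacityGap; ring
    have e3 := mul_le_mul_of_nonneg_left h1 hnr.le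
    rw [e2] at e3
    have e4 : n * (h + Real.log (L.choose l) / n) = n * h + Real.log (L.choose l) := by
      field_simp
    have e5 : n * (3 / 2 * S * (S / L)) ≤ n * ((3 / 2 * S ^ 2 + 3 / 4) / L) := by
      have : 3 / 2 * S * (S / L) = (3 / 2 * S ^ 2) / L := by ring
      rw [this]
      gcongr
      linarith
    rw [e4] at e3
    rw [e1]
    unfold tiltExponent at e3 ⊢
    linarith
  have hnoise := measure_noise_le (n := n) (M := M) hS hσ hL hθ s (t := t) hα0 hl₂ hl₂'
  refine (measure_mono hsub).trans ((measure_union_le _ _).trans ?_)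
  rw [two_mul]
  refine add_le_add ?_ (hnoise.trans (eexp_mono ?_))
  · calc channelLaw n L M σ (⋃ T ∈ 𝒯, ev T) ≤ ∑ T ∈ 𝒯, channelLaw n L M σ (ev T) :=
          measure_biUnion_finset_le _ _
      _ ≤ ∑ T ∈ 𝒯, eexp (n * ((3 / 2 * S ^ 2 + 3 / 4) / L) - n * h - Real.log (L.choose l)) :=
          Finset.sum_le_sum hT
      _ = eexp (Real.log (L.choose l))
          * eexp (n * ((3 / 2 * S ^ 2 + 3 / 4) / L) - n * h - Real.log (L.choose l)) := by
          rw [Finset.sum_const, h𝒯, Finset.card_powersetCard, Finset.card_univ, Fintype.card_fin,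
            nsmul_eq_mul]
          congr 1
          unfold eexp
          rw [Real.exp_log (by exact_mod_cast Nat.choose_pos hlL), ENNReal.ofReal_natCast]
      _ = _ := by
          rw [← eexp_add]
          congr 1
          ring
  · have e3 := mul_le_mul_of_nonneg_left h2 hnr.le
    have e5 : n * (3 / 4 / (L : ℝ)) ≤ n * ((3 / 2 * S ^ 2 + 3 / 4) / L) := by
      gcongr
      have := sq_nonneg S
      linarith
    linarith

lemma mulVec_messageVector (A : Matrix (Fin n) (Fin L × Fin M) ℝ) (c : ℝ) (s : Fin L → Fin M)
    (i : Fin n) : (A *ᵥ messageVector c s) i = c * ∑ j, A i (j, s j) := by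
  unfold Matrix.mulVec dotProduct messageVector
  rw [Fintype.sum_prod_type, Finset.mul_sum]
  refine Finset.sum_congr rfl fun j _ => ?_
  simp [mul_comm]

lemma sectionErrorRate_le (c : ℝ) (s s' : Fin L → Fin M) :
    sectionErrorRate (messageVector c s') (messageVector c s)
      ≤ ((diffSections s s').card : ℝ) / L := by
  unfold sectionErrorRate
  gcongr
  rw [← Set.ncard_coe_finset]
  refine Set.ncard_le_ncard ?_ (Set.toFinite _)
  intro j hj
  simp only [diffSections, Finset.coe_filter, Finset.mem_univ, true_and]
  intro hs
  apply hj
  funext k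
  simp [messageVector, hs]

/-- If the optimal decoder makes a section error rate of at least `ε`, then some message with that
many wrong sections is preferred to the true one. -/
lemma exists_prefers {c σ ε : ℝ} (hσ : 0 < σ)
    {dec : Matrix (Fin n) (Fin L × Fin M) ℝ → (Fin n → ℝ) → (Fin L × Fin M → ℝ)}
    (hdec : IsOptimalDecoder c dec) (s : Fin L → Fin M)
    {q : (Fin n → Fin L × Fin M → ℝ) × (Fin n → ℝ)}
    (hq : ε ≤ sectionErrorRate (dec (Matrix.of q.1) (Matrix.of q.1 *ᵥ messageVector c s + q.2))
      (messageVector c s)) :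
    ∃ s', ε ≤ ((diffSections s s').card : ℝ) / L ∧ Prefers (c / σ) σ s s' q := by
  obtain ⟨⟨s', hs'⟩, hmin⟩ := hdec (Matrix.of q.1) (Matrix.of q.1 *ᵥ messageVector c s + q.2)
  have h := hmin (messageVector c s) ⟨s, rfl⟩
  rw [← hs'] at hq h
  refine ⟨s', hq.trans (sectionErrorRate_le c s s'), ?_⟩
  unfold normSqEuclid at h
  simp only [Pi.sub_apply, Pi.add_apply, mulVec_messageVector, Matrix.of_apply] at h
  unfold Prefers rowSum
  have e1 : ∀ i, (q.2 i / σ + c / σ * ∑ j, q.1 i (j, s j) - c / σ * ∑ j, q.1 i (j, s' j)) ^ 2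
      = (c * ∑ j, q.1 i (j, s j) + q.2 i - c * ∑ j, q.1 i (j, s' j)) ^ 2 * (σ ^ 2)⁻¹ := by
    intro i
    field_simp
    ring
  have e2 : ∀ i, (q.2 i / σ) ^ 2 = (c * ∑ j, q.1 i (j, s j) + q.2 i - c * ∑ j, q.1 i (j, s j)) ^ 2
      * (σ ^ 2)⁻¹ := by
    intro i
    field_simp
    ring
  simp_rw [e1, e2]
  rw [← Finset.sum_mul, ← Finset.sum_mul]
  gcongr

end Decoding

/-! ### Assembly of the final bound -/

lemma entropyDominated_of_aStar_le {S : ℝ} (hS : 0 < S) {n L M : ℕ} {R a : ℝ} (hL : 2 ≤ L)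
    (hR0 : 0 < R) (hR : (n : ℝ) * R = L * Real.log M) (hM : (M : ℝ) = (L : ℝ) ^ a)
    (ha : aStar L S R ≤ a) : EntropyDominated S L n := by
  intro k hk1 hkL
  have hLr : (0 : ℝ) < L := by exact_mod_cast (by omega : 0 < L)
  have hlog : 0 < Real.log L := Real.log_pos (by exact_mod_cast (by omega : 1 < L))
  have hkr : (0 : ℝ) < k := by exact_mod_cast hk1
  have hD := chernoffD1_pos hS (α := (k : ℝ) / L) (by positivity)
    (by rw [div_lt_one hLr]; exact_mod_cast (by omega : k < L))
  have h1 := (le_csSup ((Set.finite_Icc 1 (L - 1)).image _).bddAbove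
    (Set.mem_image_of_mem _ (Set.mem_Icc.2 ⟨hk1, by omega⟩))).trans ha
  change R * Real.log (L.choose k) /
    (chernoffD1 (capacityGap S ((k : ℝ) / L)) (decorrelation S ((k : ℝ) / L)) * L * Real.log L)
      ≤ a at h1
  rw [div_le_iff₀ (by positivity)] at h1
  have hMlog : Real.log M = a * Real.log L := by rw [hM, Real.log_rpow hLr]
  rw [hMlog] at hR
  -- The denominator of `aStar` times `a` contains `L a log L = L log M = n R`, so the factor `R`
  -- cancels.
  refine le_of_mul_le_mul_left ?_ hR0
  calc R * Real.log (L.choose k) ≤ _ := h1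
    _ = chernoffD1 (capacityGap S ((k : ℝ) / L)) (decorrelation S ((k : ℝ) / L))
        * (L * (a * Real.log L)) := by ring
    _ = _ := by rw [← hR]; ring

lemma exists_eq_exp_neg_mul {n : ℕ} (hn : 0 < n) {p : ℝ≥0∞} {x : ℝ} (h : p ≤ eexp (-(n * x))) :
    ∃ E : EReal, p = EReal.exp (-((n : EReal) * E)) ∧ (x : EReal) ≤ E := by
  have hnr : (0 : ℝ) < n := by exact_mod_cast hn
  rcases eq_or_ne p 0 with rfl | hp
  · refine ⟨⊤, ?_, le_top⟩
    rw [EReal.mul_top_of_pos (by exact_mod_cast hn)]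
    simp
  · have hpt : p ≠ ∞ := ne_top_of_le_ne_top (eexp_ne_top _) h
    have hr : 0 < p.toReal := ENNReal.toReal_pos hp hpt
    refine ⟨((-(Real.log p.toReal / n) : ℝ) : EReal), ?_, ?_⟩
    · have : -((n : EReal) * ((-(Real.log p.toReal / n) : ℝ) : EReal))
          = ((Real.log p.toReal : ℝ) : EReal) := by
        rw [← EReal.coe_coe_eq_natCast, ← EReal.coe_mul, ← EReal.coe_neg]
        congr 1
        field_simp
      rw [this, EReal.exp_coe, Real.exp_log hr, ENNReal.ofReal_toReal hpt]
    · rw [EReal.coe_le_coe_iff]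
      have h1 : p.toReal ≤ Real.exp (-(n * x)) := by
        rw [eexp] at h
        exact ENNReal.toReal_le_of_le_ofReal (Real.exp_pos _).le h
      have h2 := Real.log_le_log hr h1
      rw [Real.log_exp] at h2
      rw [le_neg, div_le_iff₀ hnr]
      linarith

/-- A bound for each message implies the same bound for the average over the messages. -/
lemma excessErrorProb_le {n L M : ℕ} (hM : 0 < M) {P σ ε : ℝ}
    {dec : Matrix (Fin n) (Fin L × Fin M) ℝ → (Fin n → ℝ) → (Fin L × Fin M → ℝ)} {b : ℝ≥0∞}
    (h : ∀ s : Fin L → Fin M, channelLaw n L M σ {q | ε ≤ sectionErrorRate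
        (dec (Matrix.of q.1) (Matrix.of q.1 *ᵥ messageVector (flatCoeff P L) s + q.2))
        (messageVector (flatCoeff P L) s)} ≤ b) :
    excessErrorProb P σ ε dec ≤ b := by
  have hM0 : (M : ℝ≥0∞) ^ L ≠ 0 := pow_ne_zero _ (by exact_mod_cast hM.ne')
  have hMt : (M : ℝ≥0∞) ^ L ≠ ∞ := ENNReal.pow_ne_top (ENNReal.natCast_ne_top M)
  calc excessErrorProb P σ ε dec ≤ ((M : ℝ≥0∞) ^ L)⁻¹ * ∑ _s : Fin L → Fin M, b := by
        unfold excessErrorProb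
        gcongr with s
        exact h s
    _ = ((M : ℝ≥0∞) ^ L)⁻¹ * ((M : ℝ≥0∞) ^ L * b) := by
        simp
    _ = b := by rw [← mul_assoc, ENNReal.inv_mul_cancel hM0 hMt, one_mul]

/-- The bound on the error probability as an explicit exponential. -/
theorem exists_excessErrorProb_le {S : ℝ} (hS : 0 < S) :
    ∃ K : ℝ, ∀ (n L M : ℕ) (P σ R a ε : ℝ)
      (dec : Matrix (Fin n) (Fin L × Fin M) ℝ → (Fin n → ℝ) → (Fin L × Fin M → ℝ)),
      0 < n → 2 ≤ L → 0 < P → 0 < σ → P / σ ^ 2 = S → (n : ℝ) * R = L * Real.log M →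
      (M : ℝ) = (L : ℝ) ^ a → aStar L S R ≤ a → 0 < capacity S - R → 0 < ε →
      IsOptimalDecoder (flatCoeff P L) dec →
      excessErrorProb P σ ε dec
        ≤ eexp (-(n * (hExponent S ε (capacity S - R) - K * (1 / √(L : ℝ))))) := by
  obtain ⟨K₁, hK₁, L₀, htilts⟩ := exists_hasTilts hS
  set hmax := capacity S ^ 2 / (8 * S) with hhmax
  have hmax0 : 0 ≤ hmax := by positivity
  -- Three demands: exponents large enough for `exists_hasTilts`, absorption of all the `O(1/L)`
  -- losses, and a trivial bound for `L < L₀`, where no exponent exceeds `hmax`.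
  refine ⟨max (max K₁ (3 / 2 * S ^ 2 + 3 / 4 + S)) (hmax * √(L₀ : ℝ)), ?_⟩
  set K := max (max K₁ (3 / 2 * S ^ 2 + 3 / 4 + S)) (hmax * √(L₀ : ℝ)) with hK
  have hKa : K₁ ≤ K := (le_max_left _ _).trans (le_max_left _ _)
  have hKb : 3 / 2 * S ^ 2 + 3 / 4 + S ≤ K := (le_max_right _ _).trans (le_max_left _ _)
  have hKc : hmax * √(L₀ : ℝ) ≤ K := le_max_right _ _
  intro n L M P σ R a ε dec hn hL hP hσ hPS hR hMa ha hΔ hε hdec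
  have hnr : (0 : ℝ) < n := by exact_mod_cast hn
  have hLr : (0 : ℝ) < L := by exact_mod_cast (by omega : 0 < L)
  have hL1 : (1 : ℝ) ≤ L := by exact_mod_cast (by omega : 1 ≤ L)
  have hsL : 0 < √(L : ℝ) := Real.sqrt_pos.2 hLr
  have hMr : (0 : ℝ) < M := by rw [hMa]; positivity
  have hM : 0 < M := by exact_mod_cast hMr
  refine excessErrorProb_le hM fun s => ?_
  set H := hExponent S ε (capacity S - R) with hH
  rcases le_or_gt H (K * (1 / √(L : ℝ))) with htriv | hbig
  · refine le_trans ?_ (one_le_eexp ?_)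
    · have : IsProbabilityMeasure (channelLaw n L M σ) := by
        unfold channelLaw bernoulliDictionary awgnNoise
        infer_instance
      exact prob_le_one
    · have : n * (H - K * (1 / √(L : ℝ))) ≤ n * 0 := by gcongr; linarith
      linarith
  have hsub : {q | ε ≤ sectionErrorRate
        (dec (Matrix.of q.1) (Matrix.of q.1 *ᵥ messageVector (flatCoeff P L) s + q.2))
        (messageVector (flatCoeff P L) s)}
      ⊆ ⋃ l ∈ (Finset.Icc 1 L).filter (fun l : ℕ => ε ≤ (l : ℝ) / L),
        {q | ∃ s', (diffSections s s').card = l ∧ Prefers (flatCoeff P L / σ) σ s s' q} := by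
    intro q hq
    obtain ⟨s', h1, h2⟩ := exists_prefers hσ hdec s hq
    refine Set.mem_biUnion (x := (diffSections s s').card) ?_ ⟨s', rfl, h2⟩
    rw [Finset.mem_coe, Finset.mem_filter, Finset.mem_Icc]
    refine ⟨⟨?_, (Finset.card_le_univ _).trans (by simp)⟩, h1⟩
    by_contra hc
    have : (diffSections s s').card = 0 := by omega
    rw [this] at h1
    simp at h1
    linarith
  refine (measure_mono hsub).trans ((measure_biUnion_finset_le _ _).trans ?_)
  -- For `M = 1` the rate is `0` and the condition on `aStar` carries no information, but there is
  -- no competitor. Otherwise `R > 0`.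
  rcases (show 1 ≤ M from hM).eq_or_lt with hM1 | hM2
  · refine le_trans (le_of_eq ?_) zero_le
    refine Finset.sum_eq_zero fun l hl => ?_
    convert measure_empty (μ := channelLaw n L M σ)
    ext q
    simp only [Set.mem_ofPred_eq, Set.mem_empty_iff_false, iff_false]
    rintro ⟨s', hc, -⟩
    have h1 : (diffSections s s').card = 0 := by
      rw [Finset.card_eq_zero]
      refine Finset.filter_eq_empty_iff.2 fun j _ => ?_
      subst hM1
      simp [Subsingleton.elim (s' j) (s j)]
    have := (Finset.mem_Icc.1 (Finset.mem_filter.1 hl).1).1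
    omega
  have hlogM : 0 < Real.log M := Real.log_pos (by exact_mod_cast hM2)
  have hR0 : 0 < R := by
    have : 0 < (n : ℝ) * R := by rw [hR]; positivity
    exact (pos_iff_pos_of_mul_pos this).1 hnr
  have hent := entropyDominated_of_aStar_le hS hL hR0 hR hMa ha
  have hnL := hent.mul_log_le hS hnr hL
  have hθ : L * (flatCoeff P L / σ) ^ 2 = S := by
    unfold flatCoeff
    rw [div_pow, Real.sq_sqrt (by positivity), ← hPS]
    field_simp
  have hHg : H ≤ 1 / 4 * gFun ((capacity S - R) / (2 * √S)) := min_le_right _ _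
  have hHmax : H ≤ hmax := by
    have hg := gFun_le ((capacity S - R) / (2 * √S))
    rw [div_pow, mul_pow, Real.sq_sqrt hS.le] at hg
    have h1 : (capacity S - R) ^ 2 ≤ capacity S ^ 2 := by
      have := hΔ.le
      gcongr
      linarith
    calc H ≤ 1 / 4 * (2 * ((capacity S - R) ^ 2 / (2 ^ 2 * S))) := by linarith
      _ ≤ 1 / 4 * (2 * (capacity S ^ 2 / (2 ^ 2 * S))) := by gcongr
      _ = hmax := by rw [hhmax]; field_simp; ring
  have hLL₀ : L₀ ≤ L := by
    by_contra hlt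
    have h1 : √(L : ℝ) ≤ √(L₀ : ℝ) := Real.sqrt_le_sqrt (by exact_mod_cast (by omega : L ≤ L₀))
    rw [mul_one_div, div_lt_iff₀ hsL] at hbig
    have h2 : H * √(L : ℝ) ≤ hmax * √(L₀ : ℝ) := by gcongr
    linarith
  have hK₁H : K₁ / √(L : ℝ) ≤ H := by
    refine le_trans ?_ hbig.le
    rw [mul_one_div]
    gcongr
  have hterm : ∀ l ∈ (Finset.Icc 1 L).filter (fun l : ℕ => ε ≤ (l : ℝ) / L),
      channelLaw n L M σ
        {q | ∃ s', (diffSections s s').card = l ∧ Prefers (flatCoeff P L / σ) σ s s' q}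
      ≤ 2 * eexp (n * ((3 / 2 * S ^ 2 + 3 / 4) / L) - n * H) := by
    intro l hl
    obtain ⟨hl1, hlε⟩ := Finset.mem_filter.1 hl
    obtain ⟨hl1, hlL⟩ := Finset.mem_Icc.1 hl1
    refine measure_prefers_le hS hσ hn hθ s hl1 hlL hR ?_
    refine htilts L l n R H hnr hLL₀ hL hl1 hlL hR0.le (by linarith) hent ?_ hHg hK₁H
    have hw := wFun_nonneg hS
    calc H ≤ ε * (capacity S - R) * wFun S := min_le_left _ _
      _ ≤ _ := by gcongr
  calc _ ≤ ∑ l ∈ (Finset.Icc 1 L).filter (fun l : ℕ => ε ≤ (l : ℝ) / L),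
        2 * eexp (n * ((3 / 2 * S ^ 2 + 3 / 4) / L) - n * H) := Finset.sum_le_sum hterm
    _ ≤ L * (2 * eexp (n * ((3 / 2 * S ^ 2 + 3 / 4) / L) - n * H)) := by
        rw [Finset.sum_const, nsmul_eq_mul]
        gcongr
        exact (Finset.card_filter_le _ _).trans (by simp)
    _ ≤ eexp (n * (S / L)) * eexp (n * ((3 / 2 * S ^ 2 + 3 / 4) / L) - n * H) := by
        rw [← mul_assoc]
        gcongr
        -- The union over the number of wrong sections costs `2L ≤ L²`, and `2 L log L ≤ n S` turns
        -- this into a loss of `S/L` in the exponent.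
        have h1 : (L : ℝ) * 2 ≤ Real.exp (n * (S / L)) := by
          have h2 : 2 * Real.log L ≤ n * (S / L) := by
            rw [← mul_div_assoc, le_div_iff₀ hLr]
            linarith
          have hL2 : (2 : ℝ) ≤ L := by exact_mod_cast hL
          calc (L : ℝ) * 2 ≤ L * L := by gcongr
            _ = Real.exp (2 * Real.log L) := by
              rw [two_mul, Real.exp_add, Real.exp_log hLr]
            _ ≤ _ := Real.exp_le_exp.2 h2
        calc (L : ℝ≥0∞) * 2 = ENNReal.ofReal (L * 2) := by
              rw [ENNReal.ofReal_mul hLr.le, ENNReal.ofReal_natCast]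
              norm_num
          _ ≤ _ := ENNReal.ofReal_le_ofReal h1
    _ ≤ _ := by
        rw [← eexp_add]
        refine eexp_mono ?_
        have h1 : 1 / (L : ℝ) ≤ 1 / √(L : ℝ) := by
          apply one_div_le_one_div_of_le hsL
          rw [Real.sqrt_le_left hLr.le]
          nlinarith
        have h2 : (3 / 2 * S ^ 2 + 3 / 4 + S) * (1 / (L : ℝ)) ≤ K * (1 / √(L : ℝ)) := by
          have : 0 ≤ K := by linarith
          gcongr
        have h3 := mul_le_mul_of_nonneg_left h2 hnr.le
        have h4 : n * (S / L) + (n * ((3 / 2 * S ^ 2 + 3 / 4) / L) - n * H)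
            = n * ((3 / 2 * S ^ 2 + 3 / 4 + S) * (1 / (L : ℝ))) - n * H := by ring
        rw [h4]
        linarith

end

theorem mainTheorem4 (snr : ℝ) (hsnr : 0 < snr) :
    ∃ ι : ℕ → ℝ, (ι =O[atTop] fun L : ℕ => 1 / √(L : ℝ)) ∧
      ∀ (n L M : ℕ) (P σ R a ε : ℝ)
        (dec : Matrix (Fin n) (Fin L × Fin M) ℝ → (Fin n → ℝ) → (Fin L × Fin M → ℝ)),
        0 < n → 2 ≤ L → 0 < P → 0 < σ → P / σ ^ 2 = snr →
        (n : ℝ) * R = L * Real.log M →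
        (M : ℝ) = (L : ℝ) ^ a →
        aStar L snr R ≤ a →
        0 < capacity snr - R →
        0 < ε →
        IsOptimalDecoder (flatCoeff P L) dec →
        ∃ E : EReal,
          excessErrorProb P σ ε dec = EReal.exp (-((n : EReal) * E)) ∧
          ((hExponent snr ε (capacity snr - R) - ι L : ℝ) : EReal) ≤ E := by
  obtain ⟨K, hK⟩ := exists_excessErrorProb_le hsnr
  refine ⟨fun L => K * (1 / √(L : ℝ)), (isBigO_refl _ _).const_mul_left K, ?_⟩
  intro n L M P σ R a ε dec hn hL hP hσ hPS hR hMa ha hΔ hε hdec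
  exact exists_eq_exp_neg_mul hn
    (hK n L M P σ R a ε dec hn hL hP hσ hPS hR hMa ha hΔ hε hdec)
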